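/- Let $k$ be a field and let $B$ be a Brauer tree algebra over $k$: a finite-dimensional symmetric $k$-algebra whose simple modules are labelled by the $d\ge 1$ edges of a Brauer tree $\Gamma$ (a finite planar tree with an exceptional vertex of some multiplicity $m\geq 1$), such that for each edge $e$, with endpoints $v,w$, the projective cover $P$ of the corresponding simple module satisfies $\mathrm{rad}\,P=U_v+U_w$, with $U_v\cap U_w$ simple and $U_v$ uniserial, the radical layers of $U_v$ being the simple modules met after $e$ when going $m_v$ times around $v$ from $e$ back to $e$ (here $m_v=m$ if $v$ is exceptional and $m_v=1$ otherwise), and similarly for $U_w$. Let $b$ be a Brauer tree algebra over $k$ of a star with $d$ edges, all incident to the exceptional vertex, and label its simple modules $T_i$ $(i\in\mathbb Z/d)$ so that the first $d$ radical layers of the projective cover of $T_i$ are $T_i,T_{i+1},\dots,T_{i+d-1}$. *Algorithm.* Let $S_i$ $(i\in\mathbb Z/d)$ be an ordering of the simple $B$-modules and $\pi$ a $\mathbb Z_{\ge0}$-valued function on the simple $B$-modules; write $\pi(T_i)=\pi(S_i)$. The algorithm applied to $(\pi,\{S_i\})$ attaches to each $S_i$ a complex $X_i$ of $b$-modules, unique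 up to isomorphism. Put $n=\pi(S_i)$. If $n=0$ then $X_i$ is $T_i$ in degree $0$. If $n>0$, the term $P_n$ in degree $-n$ is the projective cover of $T_i$, and $M_n$ is the largest submodule of $P_n$ containing $\mathrm{soc}\,P_n\cong T_i$ such that all composition factors $T_\alpha$ of $M_n/T_i$ have $\pi(T_\alpha)<n$; put $L_n=P_n/M_n$. For $j=n-1,\dots,1$, the term $P_j$ in degree $-j$ is the injective hull of $L_{j+1}$, $M_j$ is the largest submodule of $P_j$ containing $L_{j+1}$ such that all composition factors $T_\alpha$ of $M_j/L_{j+1}$ have $\pi(T_\alpha)<j$, and $L_j=P_j/M_j$. The term in degree $0$ is $L_1$, and the differentials are the natural maps $P_{j+1}\to L_{j+1}\hookrightarrow P_j$ and $P_1\to L_1$. The alternating sum of the cohomology of $X_i$ is $$H(S_i)=\sum_{j=0}^{n}\ \sum_{T_\alpha\in \mathrm{cf}(H^{-j}(X_i))}(-1)^{j-\pi(T_\alpha)}\,S_\alpha ,$$ where $\mathrm{cf}$ denotes composition factors with multiplicity, and each simple $b$-module $T_\alpha$ is recorded through the simple $B$-module $S_\alpha$ matched with it by the ordering. Two pairs $(\pi,\{S_i\})$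 and $(\pi',\{S'_i\})$ are *algorithmically equivalent* if, whenever $S_i\cong S'_j$, the complexes $X_i$ and $X'_j$ which the algorithm attaches to $S_i$ (for the first pair) and to $S'_j$ (for the second) have isomorphic terms in degree $0$ (as $b$-modules), and $H(S_i)=H'(S'_j)$ for their alternating sums of cohomology. *Canonical data.* For a simple $B$-module $S$ let $f(S)$ be the distance in $\Gamma$ from the exceptional vertex to the endpoint of the edge of $S$ closest to it, and let $r=\max f$. A canonical perversity function is $\pi_0=r-f$ or $\pi_0=r-f+1$. An ordering $S_1,\dots,S_d$ is canonical for $\pi_0$ if the algorithm applied to $(\pi_0,\{S_i\})$ recovers the decomposition matrix of $B$: replacing each $S_\alpha$ in $H(S_i)$ by the sum of all the simple $B$-modules whose edges are incident to the far vertex of $S_\alpha$ (the endpoint of the edge of $S_\alpha$ farther from the exceptional vertex) yields $S_i$, for every $i$. **Theorem.** Let $\pi_0$ be a canonical perversity function for $B$, and let $S_1,\dots,S_d$ be the simple $B$-modules in a canonical ordering for $\pi_0$. Let $\pi'$ be a $\mathbb Z_{\ge0}$-valued function on the simple $B$-modules such that: 1. if $S_i$ and $S_j$ share a non-exceptional vertex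 of $\Gamma$, with $S_j$ closer to the exceptional vertex than $S_i$, then $\pi'(S_j)-\pi'(S_i)$ is positive; 2. $\pi'(S_i)-\pi_0(S_i)$ is a non-negative even integer for every $i$. Then there is an ordering $S'_1,\dots,S'_d$ of the simple $B$-modules such that the pairs $(\pi_0,\{S_i\})$ and $(\pi',\{S'_i\})$ are algorithmically equivalent. -/

import Mathlib

open CategoryTheory

noncomputable section

/-! ### Brauer trees -/

/-- A Brauer tree: a finite tree with at least one edge, a distinguished (exceptional) vertex with a
multiplicity `m ≥ 1`, and a cyclic ordering of the edges around each vertex; `next v` sends an edge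
at `v` to its successor in the cyclic ordering at `v` (and fixes every other edge). -/
structure BrauerTree where
  /-- the vertices -/
  V : Type
  [fintypeV : Fintype V]
  [nontrivialV : Nontrivial V]
  /-- the underlying graph -/
  graph : SimpleGraph V
  isTree : graph.IsTree
  /-- the exceptional vertex -/
  exc : V
  /-- the exceptional multiplicity -/
  excMult : ℕ
  one_le_excMult : 1 ≤ excMult
  /-- the successor in the cyclic ordering at a vertex -/
  next : V → Equiv.Perm graph.edgeSet
  /-- the edges at `v` form a single cycle of `next v` -/
  next_orbit : ∀ (v : V) (e f : graph.edgeSet), v ∈ e.1 →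
    (v ∈ f.1 ↔ ∃ n : ℕ, ((next v) ^ n) e = f)
  next_of_notMem : ∀ (v : V) (e : graph.edgeSet), v ∉ e.1 → next v e = e

namespace BrauerTree

attribute [instance] BrauerTree.fintypeV BrauerTree.nontrivialV

variable (Γ : BrauerTree)

/-- The edges of a Brauer tree. -/
abbrev Edge : Type := Γ.graph.edgeSet

/-- The multiplicity of a vertex. -/
def mult (v : Γ.V) : ℕ := open Classical in if v = Γ.exc then Γ.excMult else 1

/-- The number of edges at a vertex. -/
def valency (v : Γ.V) : ℕ := Nat.card {e : Γ.Edge // v ∈ e.1}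

/-- Length of the path from the exceptional vertex to the endpoint of `e` closest to it. -/
def depth (e : Γ.Edge) : ℕ := (e.1.map fun v => Γ.graph.dist Γ.exc v).inf

/-- The largest value of `depth`. -/
def maxDepth : ℕ := ⨆ e : Γ.Edge, Γ.depth e

/-- The far vertex of `e` is the endpoint of `e` which is not the one closest to the exceptional
vertex.  `e ↦` (far vertex of `e`) is a bijection from the edges to the non-exceptional vertices. -/
def IsFarVertex (e : Γ.Edge) (v : Γ.V) : Prop :=
  v ∈ e.1 ∧ Γ.graph.dist Γ.exc v = Γ.depth e + 1

/-- The star: every edge is incident to the exceptional vertex. -/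
def IsStar : Prop := ∀ e : Γ.Edge, Γ.exc ∈ e.1

/-- The decomposition matrix (non-exceptional rows) of a Brauer tree: the row of a
non-exceptional vertex has a `1` at each edge incident to this vertex and `0` elsewhere. Rows are
labelled by edges, the edge `a` labelling the row of its far vertex. -/
def decomp (a e : Γ.Edge) : ℤ :=
  open Classical in if ∃ v, Γ.IsFarVertex a v ∧ v ∈ e.1 then 1 else 0

/-- The two canonical perversity functions `r - f` and `r - f + 1`, where `f` is the depth and `r`
its maximum. -/
def IsCanonicalPerversity (π : Γ.Edge → ℕ) : Prop :=
  (∀ e, π e = Γ.maxDepth - Γ.depth e) ∨ (∀ e, π e = Γ.maxDepth - Γ.depth e + 1)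

end BrauerTree

/-! ### Modules -/

section Modules

universe u v w

variable {R : Type u} [Ring R]

/-- The subquotient `B / A` of a module (for submodules `A ≤ B`). -/
abbrev Subquot {X : Type v} [AddCommGroup X] [Module R X] (A B : Submodule R X) : Type v :=
  B ⧸ A.submoduleOf B

/-- `p : P → M` is a projective cover: `P` is projective and `p` is surjective with superfluous
kernel. -/
def IsProjectiveCover {P M : Type v} [AddCommGroup P] [Module R P] [AddCommGroup M] [Module R M]
    (p : P →ₗ[R] M) : Prop :=
  Module.Projective R P ∧ Function.Surjective p ∧
    ∀ N : Submodule R P, N ⊔ LinearMap.ker p = ⊤ → N = ⊤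

/-- `X` is an injective hull of its submodule `L`: `X` is injective and `L` is essential in `X`. -/
def IsInjectiveHull {X : Type v} [AddCommGroup X] [Module R X] (L : Submodule R X) : Prop :=
  Module.Injective R X ∧ ∀ N : Submodule R X, N ⊓ L = ⊥ → N = ⊥

/-- The module `N` is uniserial of length `n`, with radical layers (from the top)
`F 0, F 1, …, F (n - 1)`: its only submodules are `N = c 0 ≥ c 1 ≥ ⋯ ≥ c n = 0`, and
`c t / c (t + 1)` is isomorphic to the simple module `F t`. -/
def IsUniserialWithLayers {X : Type v} [AddCommGroup X] [Module R X] (N : Submodule R X)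
    (n : ℕ) (F : ℕ → ModuleCat.{v} R) : Prop :=
  ∃ c : ℕ → Submodule R X, c 0 = N ∧ c n = ⊥ ∧
    (∀ t < n, c (t + 1) ≤ c t ∧ IsSimpleModule R (F t) ∧
      Nonempty (Subquot (c (t + 1)) (c t) ≃ₗ[R] F t)) ∧
    ∀ N' ≤ N, ∃ t ≤ n, N' = c t

/-- The composition factors of the subquotient `M / L` (its simple subquotients) are all isomorphic
to some `T α` with `α ∈ C`. -/
def FactorsIn {ι : Type w} (T : ι → ModuleCat.{v} R) (C : Set ι) {X : Type v} [AddCommGroup X]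
    [Module R X] (L M : Submodule R X) : Prop :=
  ∀ A B : Submodule R X, L ≤ A → A ≤ B → B ≤ M → IsSimpleModule R (Subquot A B) →
    ∃ α ∈ C, Nonempty (Subquot A B ≃ₗ[R] T α)

/-- The multiplicity of the simple module `S` as a composition factor of the module `M` of finite
length: the number of factors isomorphic to `S` in a composition series of `M`. (The set below has
exactly one element, by the Jordan–Hölder theorem.) -/
def compositionMultiplicity (M S : ModuleCat.{v} R) : ℕ :=
  sSup {n : ℕ | ∃ s : CompositionSeries (Submodule R M), s.head = ⊥ ∧ s.last = ⊤ ∧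
    n = Nat.card {t : Fin s.length // Nonempty (Subquot (s t.castSucc) (s t.succ) ≃ₗ[R] S)}}

end Modules

/-! ### Brauer tree algebras -/

section Algebras

universe u w

/-- `B` is a Brauer tree algebra with Brauer tree `Γ` over the field `k`, with its simple modules
labelled by the edges of `Γ`: `B` is a finite-dimensional symmetric `k`-algebra and, if `P` is the
projective cover of the simple module labelled by an edge `e` with endpoints `v`, `w`, then
`rad P = U v + U w`, where `U v ∩ U w` is simple and `U v` is uniserial, its radical layers being
labelled by the edges met after `e` when going `mult v` times around `v` from `e` back to `e`. -/
structure BrauerTreeAlgebra (k : Type w) [Field k] (Γ : BrauerTree) (B : Type u) [Ring B]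
    [Algebra k B] where
  finite : Module.Finite k B
  /-- `B` is a symmetric algebra -/
  symmetric : ∃ t : B →ₗ[k] k, (∀ x y, t (x * y) = t (y * x)) ∧
    ∀ x, (∀ y, t (x * y) = 0) → x = 0
  /-- the simple module labelled by an edge -/
  simple : Γ.Edge → ModuleCat.{u} B
  isSimple : ∀ e, IsSimpleModule B (simple e)
  simple_injective : ∀ e f, Nonempty (simple e ≃ₗ[B] simple f) → e = f
  simple_exhaustive : ∀ S : ModuleCat.{u} B, IsSimpleModule B S →
    ∃ e, Nonempty (S ≃ₗ[B] simple e)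
  /-- the structure of the projective indecomposable modules -/
  proj : ∀ e : Γ.Edge, ∃ (P : ModuleCat.{u} B) (p : P →ₗ[B] simple e) (U : Γ.V → Submodule B P),
    IsProjectiveCover p ∧
    (∀ v ∈ e.1, IsUniserialWithLayers (U v) (Γ.mult v * Γ.valency v)
      fun t => simple (((Γ.next v) ^ (t + 1)) e)) ∧
    ∀ v w, e.1 = s(v, w) →
      U v ⊔ U w = LinearMap.ker p ∧ IsSimpleModule B (U v ⊓ U w : Submodule B P)

end Algebras

/-! ### The perverse equivalence algorithm -/

section Algorithm

universe u w

variable {R : Type u} [Ring R] {ι : Type w}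

/-- `X` is a complex obtained by applying the algorithm to the `i`-th simple module, for the simple
`R`-modules `T α` and the perversity function `π`. The term of `X` in homological degree `j` is the
term in cohomological degree `-j`. Writing `n = π i`:
* if `n = 0` then `X` is `T i` in degree `0`;
* if `n > 0`, the term in degree `-n` is the projective cover `P` of `T i`, and the kernel of its
  differential is the largest submodule `M ≥ T i = soc P` such that `M / T i` has only composition
  factors `T α` with `π α < n`;
* for `0 < j < n` the term in degree `-j` is the injective hull of the image `L` of the previous
  differential, and the kernel of its differential is the largest submodule `M ≥ L` such that
  `M / L` has only composition factors `T α` with `π α < j`;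
* the differential into the degree `0` term is surjective. -/
def IsAlgorithmComplex (T : ι → ModuleCat.{u} R) (π : ι → ℕ) (i : ι)
    (X : ChainComplex (ModuleCat.{u} R) ℕ) : Prop :=
  (∀ j, π i < j → Subsingleton (X.X j)) ∧
  (π i = 0 → Nonempty (X.X 0 ≅ T i)) ∧
  (0 < π i → Function.Surjective (X.d 1 0).hom) ∧
  (∀ j, j + 1 = π i →
    (∃ p : X.X (j + 1) →ₗ[R] T i, IsProjectiveCover p) ∧
    ∃ s : Submodule R (X.X (j + 1)), Nonempty (s ≃ₗ[R] T i) ∧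
      IsGreatest {M | s ≤ M ∧ FactorsIn T {α | π α < j + 1} s M}
        (LinearMap.ker (X.d (j + 1) j).hom)) ∧
  (∀ j, j + 1 < π i →
    IsInjectiveHull (LinearMap.range (X.d (j + 2) (j + 1)).hom) ∧
    IsGreatest {M | LinearMap.range (X.d (j + 2) (j + 1)).hom ≤ M ∧
        FactorsIn T {α | π α < j + 1} (LinearMap.range (X.d (j + 2) (j + 1)).hom) M}
      (LinearMap.ker (X.d (j + 1) j).hom))

/-- The coefficient of the simple module with index `α` in the alternating sum of the cohomology
`∑_{j = 0}^{n} ∑_{T β ∈ cf(H^{-j}(X))} (-1)^{j - π β} T β` of the complex `X`. -/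
def altCohomology (T : ι → ModuleCat.{u} R) (π : ι → ℕ) (n : ℕ)
    (X : ChainComplex (ModuleCat.{u} R) ℕ) (α : ι) : ℤ :=
  ∑ j ∈ Finset.range (n + 1),
    ((j : ℤ) - (π α : ℤ)).negOnePow * (compositionMultiplicity (X.homology j) (T α) : ℤ)

end Algorithm

/-! ### Orderings of the simple modules -/

section Orderings

universe u v w

variable {k : Type w} [Field k] {Γ Δ : BrauerTree} {d : ℕ} [NeZero d]
  {B : Type u} [Ring B] [Algebra k B] {b : Type v} [Ring b] [Algebra k b]

/-- The edges of the star `Δ` listed in the cyclic ordering at the exceptional vertex. For the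
algebra of the star this says that the first `d` radical layers of the projective cover of the
simple module `T i` are `T i, T (i + 1), …, T (i + d - 1)`, with indices modulo `d`. -/
def IsCyclicLabelling (τ : ZMod d ≃ Δ.Edge) : Prop :=
  ∀ i, Δ.next Δ.exc (τ i) = τ (i + 1)

/-- The simple modules `T i` of the algebra of the star. -/
def starSimple (hb : BrauerTreeAlgebra k Δ b) (τ : ZMod d ≃ Δ.Edge) (i : ZMod d) :
    ModuleCat.{v} b :=
  hb.simple (τ i)

/-- An ordering `S i = hB.simple (σ i)` of the simple `B`-modules is canonical for the
canonical perversity function `π₀` if the algorithm applied to `(π₀, S)` recovers the decomposition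
matrix of `B`: for the complex `X i` of `S i`, replacing each `T α` in the alternating sum of
the cohomology of `X i` by the row of the decomposition matrix attached to `S α` yields `S i`. -/
def IsCanonicalOrdering (T : ZMod d → ModuleCat.{v} b) (π₀ : Γ.Edge → ℕ) (σ : ZMod d ≃ Γ.Edge) :
    Prop :=
  ∀ i, ∃ X : ChainComplex (ModuleCat.{v} b) ℕ, IsAlgorithmComplex T (π₀ ∘ σ) i X ∧
    ∀ e, ∑ α, altCohomology T (π₀ ∘ σ) (π₀ (σ i)) X α * Γ.decomp (σ α) e
      = open Classical in if e = σ i then 1 else 0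

/-- Algorithmic equivalence of `(π, S)` and `(π', S')`, where `S i = hB.simple (σ i)` and
`S' i = hB.simple (σ' i)`: whenever `S i ≅ S' j`, the complexes `X` and `X'` that the algorithm
yields for `S i` and `S' j` have isomorphic terms in degree `0`, and the same alternating sum of
cohomology when the simple `b`-module `T α` is identified with the simple `B`-module matched with
it, which is `S α` for the first pair and `S' α` for the second one. -/
def AlgorithmicallyEquivalent (hB : BrauerTreeAlgebra k Γ B) (T : ZMod d → ModuleCat.{v} b)
    (π : Γ.Edge → ℕ) (σ : ZMod d ≃ Γ.Edge) (π' : Γ.Edge → ℕ) (σ' : ZMod d ≃ Γ.Edge) : Prop :=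
  ∀ i j, Nonempty (hB.simple (σ i) ≅ hB.simple (σ' j)) →
    (∃ X, IsAlgorithmComplex T (π ∘ σ) i X) ∧
    (∃ X', IsAlgorithmComplex T (π' ∘ σ') j X') ∧
    ∀ X X', IsAlgorithmComplex T (π ∘ σ) i X → IsAlgorithmComplex T (π' ∘ σ') j X' →
      Nonempty (X.X 0 ≅ X'.X 0) ∧
      ∀ e, altCohomology T (π ∘ σ) (π (σ i)) X (σ.symm e) =
        altCohomology T (π' ∘ σ') (π' (σ' j)) X' (σ'.symm e)

end Orderings

end

/-!
The algebra of the star is a symmetric Nakayama algebra: its indecomposable projective modules are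
uniserial of length `N ≡ 1` modulo `d`, with the simple modules `T i` occurring cyclically as layers,
and they are injective (`BrauerTreeAlgebra.isCyclicSystem`). A uniserial module is thus determined
by its top and its length, and the algorithm only has to keep track of the labels of the tops and of
the socles of the modules `L j`. Lifting the labels from `ZMod d` to `ℤ`, these form two sequences
of integers, moving in turn. Each starts at `i`, and the move in degree `-j` goes down to the first
position at which the perversity is at least `j` (`IsTrajectory`). The positions passed over are
the composition factors of the cohomology. Hence the term in degree `0` depends on the endpoints
only, and the alternating sum of cohomology is a signed count of positions passed over
(`IsAlgorithmComplex.uniserial_zero`, `IsAlgorithmComplex.altCohomology_eq`,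
`IsCyclicSystem.exists_isAlgorithmComplex`).

For a canonical ordering, the coefficients of an edge and of its parent in the alternating sum for
the parent cancel, by the shape of the decomposition matrix. This forces the parent of a position
`w` to be the first position above `w` with larger perversity (`eq_parent_of_first_greater`).
By hypothesis `π' = π₀ + 2 c`, where `c` increases weakly towards the exceptional vertex, so it
follows that the pair `(π₀, c)` is balanced: going up from `w` as far as the next position with
`c ≥ c w`, the perversity exceeds its value at `w` by at most one, and this only at the end
(`isBalanced_of_isCanonicalOrdering`).

The excess `2 c` is added in steps of two units. Let `J` be the set of positions with `c > 0`.
Move every label in `J` up to the next position in `J` and raise its perversity by `2`. Balance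
implies that positions in `J` can be passed over only in the first move of a descent. So descents
that start outside `J` do not change, and one that starts in `J` is replaced by a descent two units
longer which has joined the old one once both of its sequences have moved; the additional positions
passed over cancel in the alternating count (`IsTrajectory.raise_notMem`, `IsTrajectory.raise_mem`).
The balance condition is inherited by the new perversity and `c - 1` (`IsBalanced.raise`), so this
can be repeated until `c` is used up, and the composite of the rotations gives the new ordering
(`IsBalanced.exists_perm`).
-/


/-! ### Descents on a circle -/

noncomputable section Circle

variable {d : ℕ}

/-- The first position strictly below `z` at which the `d`-periodic function `f` is at least `j`. -/
structure IsStop (f : ZMod d → ℕ) (j : ℕ) (z s : ℤ) : Prop where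
  lt : s < z
  le : j ≤ f s
  below : ∀ y : ℤ, s < y → y < z → f y < j

/-- The descent from position `i`: two interleaved sequences (even and odd times), both
starting at `i`; at time `t` the sequence of the parity of `t` moves down to the first position at
which `f` is at least `f i - t`. -/
structure IsTrajectory (f : ZMod d → ℕ) (i : ℤ) (x : ℕ → ℤ) : Prop where
  zero : x 0 = i
  one : x 1 = i
  isStop : ∀ t < f i, IsStop f (f i - t) (x t) (x (t + 2))

/-- The number of representatives of the residue class `α` strictly between `a` and `b`. -/
def residueCount (α : ZMod d) (a b : ℤ) : ℕ :=
  ((Finset.Ioo a b).filter fun z : ℤ => (z : ZMod d) = α).card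

/-- The signed count of the positions in the class `α` that are passed over by a descent `x`
from `i`, the starting position included. A position passed over at time `t` stands for a
composition factor in degree `-(f i - t)`, and `t` has the same parity as `-t`. -/
def passCount (f : ZMod d → ℕ) (i : ℤ) (x : ℕ → ℤ) (α : ZMod d) : ℤ :=
  ∑ t ∈ Finset.range (f i), (-1) ^ (f i + t + f α) * (residueCount α (x (t + 2)) (x t) : ℤ) +
    (-1) ^ (f i + f α) * (if (i : ZMod d) = α then 1 else 0)

theorem intCast_sub_mul_self (y : ℤ) (u : ℤ) : ((y - d * u : ℤ) : ZMod d) = y := by simp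

theorem IsStop.unique {f : ZMod d → ℕ} {j : ℕ} {z s s' : ℤ} (h : IsStop f j z s)
    (h' : IsStop f j z s') : s = s' := by
  rcases lt_trichotomy s s' with hlt | heq | hlt
  · have := h.below s' hlt h'.lt
    have := h'.le
    omega
  · exact heq
  · have := h'.below s hlt h.lt
    have := h.le
    omega

theorem IsTrajectory.le_apply {f : ZMod d → ℕ} {i : ℤ} {x : ℕ → ℤ} (h : IsTrajectory f i x)
    {t : ℕ} (ht : t ≤ f i + 1) : f i ≤ f (x t) + (t - 2) := by
  match t with
  | 0 => simp [h.zero]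
  | 1 => simp [h.one]
  | t + 2 =>
    have := (h.isStop t (by omega)).le
    omega

variable [NeZero d]

theorem exists_isStop {f : ZMod d → ℕ} {j : ℕ} {a : ZMod d} (ha : j ≤ f a) (z : ℤ) :
    ∃ s, IsStop f j z s := by
  classical
  have hex : ∃ u : ℕ, j ≤ f ((z - 1 - u : ℤ)) := by
    refine ⟨((z - 1 : ℤ) - a : ZMod d).val, ?_⟩
    have : (((z - 1 - (((z - 1 : ℤ) - a : ZMod d).val : ℕ) : ℤ)) : ZMod d) = a := by
      push_cast
      simp
    rwa [this]
  refine ⟨z - 1 - Nat.find hex, by omega, Nat.find_spec hex, fun y hy hyz => ?_⟩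
  have := Nat.find_min hex (m := (z - 1 - y).toNat) (by omega)
  have e : z - 1 - ((z - 1 - y).toNat : ℤ) = y := by omega
  rw [e] at this
  omega

theorem exists_isTrajectory (f : ZMod d → ℕ) (i : ℤ) : ∃ x, IsTrajectory f i x := by
  have key : ∀ (t : ℕ) (z : ℤ), ∃ s, IsStop f (f i - t) z s := fun t z =>
    exists_isStop (a := (i : ZMod d)) (Nat.sub_le _ _) z
  choose st hst using key
  -- the pair of consecutive values, from which the sequence is recovered
  let p : ℕ → ℤ × ℤ := fun t => Nat.rec (i, i) (fun t q => (q.2, st t q.1)) t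
  refine ⟨fun t => (p t).1, rfl, rfl, fun t _ => hst t _⟩

/-- The sequence at even times is never above the one at odd times, and strictly below it when it
has just moved; it is never more than one turn around the circle below. -/
theorem IsTrajectory.bounds {f : ZMod d → ℕ} {i : ℤ} {x : ℕ → ℤ} (h : IsTrajectory f i x)
    (t : ℕ) (ht : t ≤ f i) :
    (Even t → x t ≤ x (t + 1) ∧ x (t + 1) < x t + d) ∧
      (¬ Even t → x (t + 1) < x t ∧ x t ≤ x (t + 1) + d) := by
  have hd : 0 < d := NeZero.pos d
  induction t with
  | zero => simp [h.zero, h.one, hd]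
  | succ t ih =>
    have ih := ih (by omega)
    have hs := h.isStop t (by omega)
    have hb := (h.le_apply (t := t + 1) (by omega))
    have hle : f i - t ≤ f (x (t + 1)) := by omega
    rw [Nat.even_add_one]
    constructor
    · intro he
      obtain ⟨h1, h2⟩ := ih.2 he
      have : x (t + 1) ≤ x (t + 2) := by
        by_contra hc
        have := hs.below (x (t + 1)) (by omega) (by omega)
        omega
      have := hs.lt
      exact ⟨by omega, by show x (t + 2) < _; omega⟩
    · intro he
      obtain ⟨h1, h2⟩ := ih.1 (by simpa using he)
      have := hs.lt
      refine ⟨by show x (t + 2) < _; omega, ?_⟩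
      show _ ≤ x (t + 2) + d
      by_contra hc
      have h3 := hs.below (x (t + 1) - d * 1) (by omega) (by omega)
      rw [intCast_sub_mul_self] at h3
      omega

/-! ### The next position of a periodic set -/

/-- The distance from `z` to the next position above `z` in the set `J`, minus one. -/
def gapAbove (J : ZMod d → Prop) (hJ : ∃ a, J a) (z : ZMod d) : ℕ :=
  open Classical in Nat.find (p := fun u : ℕ => J (z + 1 + u)) <| by
    obtain ⟨a, ha⟩ := hJ
    exact ⟨(a - (z + 1)).val, by simpa using ha⟩

/-- The first position strictly above `z` in the periodic set `J`. -/
def nextIn (J : ZMod d → Prop) (hJ : ∃ a, J a) (z : ℤ) : ℤ := z + 1 + gapAbove J hJ z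

variable {J : ZMod d → Prop} (hJ : ∃ a, J a)

theorem lt_nextIn (z : ℤ) : z < nextIn J hJ z := by
  unfold nextIn
  omega

theorem nextIn_mem (z : ℤ) : J (nextIn J hJ z) := by
  classical
  have := Nat.find_spec (p := fun u : ℕ => J ((z : ZMod d) + 1 + u)) (by
    obtain ⟨a, ha⟩ := hJ
    exact ⟨(a - (z + 1)).val, by simpa using ha⟩)
  unfold nextIn gapAbove
  push_cast
  convert this

theorem notMem_of_lt_nextIn {z y : ℤ} (h1 : z < y) (h2 : y < nextIn J hJ z) : ¬ J y := by
  classical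
  intro hy
  have h3 : (y - z - 1).toNat < gapAbove J hJ z := by
    unfold nextIn at h2
    omega
  unfold gapAbove at h3
  have := Nat.find_min _ h3
  apply this
  have e : ((z : ZMod d) + 1 + ((y - z - 1).toNat : ℕ)) = (y : ZMod d) := by
    have : z + 1 + ((y - z - 1).toNat : ℤ) = y := by omega
    exact_mod_cast congrArg (fun n : ℤ => (n : ZMod d)) this
  rwa [e]

theorem nextIn_le {z y : ℤ} (h1 : z < y) (hy : J y) : nextIn J hJ z ≤ y := by
  by_contra hc
  exact notMem_of_lt_nextIn hJ h1 (by omega) hy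

theorem nextIn_eq {z y : ℤ} (h1 : z < y) (hy : J y) (h : ∀ w : ℤ, z < w → w < y → ¬ J w) :
    nextIn J hJ z = y := by
  refine le_antisymm (nextIn_le hJ h1 hy) ?_
  by_contra hc
  exact h _ (lt_nextIn hJ z) (by omega) (nextIn_mem hJ z)

theorem nextIn_strictMono {z w : ℤ} (h : z < w) (hw : J w) : nextIn J hJ z < nextIn J hJ w :=
  (nextIn_le hJ h hw).trans_lt (lt_nextIn hJ w)

theorem lt_of_nextIn_lt {z w : ℤ} (hz : J z) (h : nextIn J hJ z < nextIn J hJ w) : z < w := by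
  by_contra hc
  rcases eq_or_lt_of_le (not_lt.1 hc) with e | e
  · rw [e] at h
    omega
  · have := nextIn_strictMono hJ e hz
    omega

/-- The last position of `J` that is at most `q`. -/
theorem exists_floorIn (q : ℤ) : ∃ l : ℤ, J l ∧ l ≤ q ∧ q < nextIn J hJ l := by
  classical
  have hex : ∃ u : ℕ, J ((q - u : ℤ)) := by
    obtain ⟨a, ha⟩ := hJ
    refine ⟨((q : ZMod d) - a).val, ?_⟩
    push_cast
    simpa using ha
  refine ⟨q - Nat.find hex, Nat.find_spec hex, by omega, ?_⟩
  by_contra hc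
  have h1 := lt_nextIn hJ (q - Nat.find hex)
  refine Nat.find_min hex (m := (q - nextIn J hJ (q - Nat.find hex)).toNat) (by omega) ?_
  have e : q - ((q - nextIn J hJ (q - Nat.find hex)).toNat : ℤ) =
    nextIn J hJ (q - Nat.find hex) := by omega
  rw [e]
  exact nextIn_mem hJ _

theorem exists_nextIn_eq {z : ℤ} (hz : J z) : ∃ w : ℤ, J w ∧ nextIn J hJ w = z := by
  obtain ⟨l, hl, h1, h2⟩ := exists_floorIn hJ (z - 1)
  refine ⟨l, hl, nextIn_eq hJ (by omega) hz fun w h3 h4 => ?_⟩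
  exact notMem_of_lt_nextIn hJ h3 (by omega)

open Classical in
/-- The map moving each position of `J` to the next one and fixing all others. -/
def rotateFun (J : ZMod d → Prop) (hJ : ∃ a, J a) (z : ZMod d) : ZMod d :=
  if J z then z + 1 + gapAbove J hJ z else z

theorem rotateFun_mem {z : ℤ} (hz : J z) : rotateFun J hJ z = (nextIn J hJ z : ZMod d) := by
  simp [rotateFun, hz, nextIn]

theorem rotateFun_notMem {z : ZMod d} (hz : ¬ J z) : rotateFun J hJ z = z := by
  simp [rotateFun, hz]

theorem exists_intCast_eq (z : ZMod d) : ∃ w : ℤ, (w : ZMod d) = z := ⟨z.val, by simp⟩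

theorem rotateFun_surjective : Function.Surjective (rotateFun J hJ) := by
  intro z
  by_cases hz : J z
  · obtain ⟨w, rfl⟩ := exists_intCast_eq z
    obtain ⟨l, hl, h1⟩ := exists_nextIn_eq hJ hz
    exact ⟨l, by rw [rotateFun_mem hJ hl, h1]⟩
  · exact ⟨z, rotateFun_notMem hJ hz⟩

/-- The permutation rotating the positions of `J` among themselves, each moving up to the next
one. -/
def rotate (J : ZMod d → Prop) (hJ : ∃ a, J a) : Equiv.Perm (ZMod d) :=
  Equiv.ofBijective (rotateFun J hJ)
    ⟨Finite.injective_iff_surjective.2 (rotateFun_surjective hJ), rotateFun_surjective hJ⟩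

theorem rotate_mem {z : ℤ} (hz : J z) : rotate J hJ z = (nextIn J hJ z : ZMod d) :=
  rotateFun_mem hJ hz

theorem rotate_notMem {z : ZMod d} (hz : ¬ J z) : rotate J hJ z = z :=
  rotateFun_notMem hJ hz

end Circle

/-! ### Rotating a periodic set -/

noncomputable section Rotation

variable {d : ℕ}

theorem residueCount_add (α : ZMod d) {a b c : ℤ} (hab : a ≤ b) (hbc : b ≤ c)
    (hb : (b : ZMod d) ≠ α) : residueCount α a c = residueCount α a b + residueCount α b c := by
  unfold residueCount
  rw [← Finset.card_union_of_disjoint]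
  · congr 1
    ext z
    simp only [Finset.mem_filter, Finset.mem_union, Finset.mem_Ioo]
    constructor
    · rintro ⟨⟨h1, h2⟩, h3⟩
      rcases lt_trichotomy z b with h | h | h
      · exact Or.inl ⟨⟨h1, h⟩, h3⟩
      · exact absurd (h ▸ h3) hb
      · exact Or.inr ⟨⟨h, h2⟩, h3⟩
    · rintro (⟨⟨h1, h2⟩, h3⟩ | ⟨⟨h1, h2⟩, h3⟩)
      · exact ⟨⟨h1, by omega⟩, h3⟩
      · exact ⟨⟨by omega, h2⟩, h3⟩
  · rw [Finset.disjoint_left]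
    intro z h1 h2
    simp only [Finset.mem_filter, Finset.mem_Ioo] at h1 h2
    omega

theorem residueCount_eq_zero {α : ZMod d} {a b : ℤ}
    (h : ∀ y : ℤ, a < y → y < b → (y : ZMod d) ≠ α) : residueCount α a b = 0 := by
  unfold residueCount
  rw [Finset.card_eq_zero, Finset.filter_eq_empty_iff]
  intro z hz
  rw [Finset.mem_Ioo] at hz
  exact h z hz.1 hz.2

variable [NeZero d] {J : ZMod d → Prop} (hJ : ∃ a, J a)

theorem rotate_mem_iff (α : ZMod d) : J (rotate J hJ α) ↔ J α := by
  by_cases h : J α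
  · obtain ⟨w, rfl⟩ := exists_intCast_eq α
    simp only [h, iff_true]
    rw [rotate_mem hJ h]
    exact nextIn_mem hJ w
  · rw [rotate_notMem hJ h]

theorem residueCount_rotate_of_notMem {a b : ℤ} (h : ∀ y : ℤ, a < y → y < b → ¬ J y)
    (α : ZMod d) : residueCount (rotate J hJ α) a b = residueCount α a b := by
  by_cases hα : J α
  · rw [residueCount_eq_zero, residueCount_eq_zero]
    · rintro y h1 h2 rfl
      exact h y h1 h2 hα
    · intro y h1 h2 h3
      exact h y h1 h2 (h3 ▸ (rotate_mem_iff hJ α).2 hα)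
  · rw [rotate_notMem hJ hα]

/-- Rotating the positions of `J` turns the positions of `J` in the open interval from `q` to `l`
into those between the successors of the `J`-floor of `q` and of `l`. -/
theorem residueCount_rotate_of_mem {q l m : ℤ} (hl : J l) (hm : J m) (hmq : m ≤ q)
    (hqm : q < nextIn J hJ m) {α : ZMod d} (hα : J α) :
    residueCount (rotate J hJ α) (nextIn J hJ m) (nextIn J hJ l) = residueCount α q l := by
  unfold residueCount
  symm
  refine Finset.card_bij (fun w _ => nextIn J hJ w) ?_ ?_ ?_
  · intro w hw
    simp only [Finset.mem_filter, Finset.mem_Ioo] at hw ⊢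
    obtain ⟨⟨h1, h2⟩, rfl⟩ := hw
    exact ⟨⟨nextIn_strictMono hJ (by omega) hα, nextIn_strictMono hJ h2 hl⟩,
      (rotate_mem hJ hα).symm⟩
  · intro w hw w' hw' h
    simp only [Finset.mem_filter, Finset.mem_Ioo] at hw hw'
    have h1 : J w := hw.2 ▸ hα
    have h2 : J w' := hw'.2 ▸ hα
    rcases lt_trichotomy w w' with h3 | h3 | h3
    · have := nextIn_strictMono hJ h3 h2
      omega
    · exact h3
    · have := nextIn_strictMono hJ h3 h1
      omega
  · intro y hy
    simp only [Finset.mem_filter, Finset.mem_Ioo] at hy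
    obtain ⟨⟨h1, h2⟩, h3⟩ := hy
    have hyJ : J y := h3 ▸ (rotate_mem_iff hJ α).2 hα
    obtain ⟨w, hw, rfl⟩ := exists_nextIn_eq hJ hyJ
    refine ⟨w, ?_, rfl⟩
    simp only [Finset.mem_filter, Finset.mem_Ioo]
    have h4 := lt_of_nextIn_lt hJ hm h1
    have h5 := nextIn_le hJ h4 hw
    refine ⟨⟨by omega, lt_of_nextIn_lt hJ hw h2⟩, ?_⟩
    rw [← rotate_mem hJ hw] at h3
    exact (rotate J hJ).injective h3

/-- `f` does not exceed its value at a position `w` of `J` on the way up to the next position of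
`J`, where it exceeds it by at most one. -/
def IsGentle (J : ZMod d → Prop) (hJ : ∃ a, J a) (f : ZMod d → ℕ) : Prop :=
  ∀ w : ℤ, J w → (∀ y : ℤ, w < y → y < nextIn J hJ w → f y ≤ f w) ∧ f (nextIn J hJ w) ≤ f w + 1

open Classical in
/-- `f'` is obtained from `f` by rotating the positions of `J` and raising them by two. -/
def IsRaise (J : ZMod d → Prop) (hJ : ∃ a, J a) (f f' : ZMod d → ℕ) : Prop :=
  ∀ z, f' (rotate J hJ z) = f z + if J z then 2 else 0

variable {hJ} {f f' : ZMod d → ℕ}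

theorem IsRaise.mem (h : IsRaise J hJ f f') {w : ℤ} (hw : J w) :
    f' (nextIn J hJ w) = f w + 2 := by
  rw [← rotate_mem hJ hw, h, if_pos hw]

theorem IsRaise.notMem (h : IsRaise J hJ f f') {w : ZMod d} (hw : ¬ J w) : f' w = f w := by
  have := h w
  rwa [rotate_notMem hJ hw, if_neg hw] at this

theorem IsRaise.lt (h : IsRaise J hJ f f') (hg : IsGentle J hJ f) {z : ℤ} (hz : J z) :
    f z < f' z := by
  obtain ⟨w, hw, rfl⟩ := exists_nextIn_eq hJ hz
  have := (hg w hw).2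
  rw [h.mem hw]
  omega

theorem IsRaise.le (h : IsRaise J hJ f f') (hg : IsGentle J hJ f) (z : ℤ) : f z ≤ f' z := by
  by_cases hz : J z
  · exact (h.lt hg hz).le
  · exact (h.notMem hz).ge

theorem IsRaise.neg_one_pow (h : IsRaise J hJ f f') (α : ZMod d) (m : ℕ) :
    (-1 : ℤ) ^ (m + f' (rotate J hJ α)) = (-1) ^ (m + f α) := by
  rw [h α]
  split_ifs
  · rw [← add_assoc, pow_add _ _ 2]
    simp
  · simp

theorem IsGentle.notMem_of_isStop (hg : IsGentle J hJ f) {j : ℕ} {z s : ℤ} (hs : IsStop f j z s)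
    (hz : j + 1 ≤ f z ∨ (¬ J z ∧ j ≤ f z)) (y : ℤ) (h1 : s < y) (h2 : y < z) : ¬ J y := by
  intro hy
  obtain ⟨w, hw, h3, h4⟩ := exists_floorIn hJ (z - 1)
  have hyw : y ≤ w := by
    by_contra hc
    exact notMem_of_lt_nextIn hJ (z := w) (by omega) (by omega) hy
  have h5 := hs.below w (by omega) (by omega)
  rcases eq_or_lt_of_le (show z ≤ nextIn J hJ w by omega) with h6 | h6
  · have h7 := (hg w hw).2
    have h8 := nextIn_mem hJ w
    rw [← h6] at h7 h8
    rcases hz with hz | hz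
    · omega
    · exact hz.1 h8
  · have h7 := (hg w hw).1 z (by omega) h6
    rcases hz with hz | hz <;> omega

theorem IsRaise.isStop (h : IsRaise J hJ f f') (hg : IsGentle J hJ f) {j : ℕ} {z s : ℤ}
    (hs : IsStop f j z s) (hz : ∀ y : ℤ, s < y → y < z → ¬ J y) : IsStop f' j z s := by
  refine ⟨hs.lt, hs.le.trans (h.le hg s), fun y h1 h2 => ?_⟩
  rw [h.notMem (hz y h1 h2)]
  exact hs.below y h1 h2

theorem IsTrajectory.notMem (hg : IsGentle J hJ f) {i : ℤ} {x : ℕ → ℤ} (hx : IsTrajectory f i x)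
    {t : ℕ} (ht : t < f i) (h0 : t = 0 → ¬ J i) (y : ℤ) (h1 : x (t + 2) < y) (h2 : y < x t) :
    ¬ J y := by
  refine hg.notMem_of_isStop (hx.isStop t ht) ?_ y h1 h2
  rcases Nat.eq_zero_or_pos t with rfl | ht0
  · right
    rw [hx.zero]
    exact ⟨h0 rfl, by omega⟩
  · left
    have := hx.le_apply (t := t) (by omega)
    omega

/-- A descent from a position outside `J` is not affected by the rotation. -/
theorem IsTrajectory.raise_notMem (h : IsRaise J hJ f f') (hg : IsGentle J hJ f) {i : ℤ}
    {x : ℕ → ℤ} (hx : IsTrajectory f i x) (hi : ¬ J i) :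
    IsTrajectory f' i x ∧ ∀ α, passCount f' i x (rotate J hJ α) = passCount f i x α := by
  have hfi : f' i = f i := h.notMem hi
  refine ⟨⟨hx.zero, hx.one, fun t ht => ?_⟩, fun α => ?_⟩
  · rw [hfi] at ht ⊢
    exact h.isStop hg (hx.isStop t ht) (hx.notMem hg ht fun _ => hi)
  · unfold passCount
    rw [hfi]
    congr 1
    · refine Finset.sum_congr rfl fun t ht => ?_
      rw [h.neg_one_pow, residueCount_rotate_of_notMem hJ
        (hx.notMem hg (Finset.mem_range.1 ht) fun _ => hi)]
    · rw [h.neg_one_pow]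
      congr 2
      rw [eq_iff_iff]
      conv_rhs => rw [← (rotate J hJ).injective.eq_iff, rotate_notMem hJ hi]

/-- The descent from `l` in `J` is replaced, after the rotation, by one which starts at the next
position of `J` and has joined the old descent, two units of time late, once both of its sequences
have moved. -/
theorem IsTrajectory.raise_mem (h : IsRaise J hJ f f') (hg : IsGentle J hJ f) {l : ℤ}
    {x : ℕ → ℤ} (hx : IsTrajectory f l x) (hl : J l) :
    ∃ x', IsTrajectory f' (nextIn J hJ l) x' ∧ x' (f l + 2) = x (f l) ∧
      x' (f l + 3) = x (f l + 1) ∧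
      ∀ α, passCount f' (nextIn J hJ l) x' (rotate J hJ α) = passCount f l x α := by
  obtain ⟨q, hq, hxq⟩ : ∃ q, IsStop f (f l) l q ∧ (0 < f l → x 2 = q) := by
    rcases Nat.eq_zero_or_pos (f l) with h0 | h0
    · refine ⟨l - 1, ⟨by omega, by omega, fun y h1 h2 => by omega⟩, fun h => by omega⟩
    · refine ⟨x 2, ?_, fun _ => rfl⟩
      have := hx.isStop 0 h0
      rwa [hx.zero] at this
  obtain ⟨m, hm, hmq, hqm⟩ := exists_floorIn hJ q
  have hml : nextIn J hJ m ≤ l := nextIn_le hJ (by have := hq.lt; omega) hl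
  have hq0 : f l = 0 → nextIn J hJ m = l := by
    intro h0
    by_contra hc
    have := hq.below (nextIn J hJ m) hqm (by omega)
    omega
  have hfm : f l ≤ f m := by
    rcases eq_or_lt_of_le hmq with e | e
    · rw [e]
      exact hq.le
    · exact hq.le.trans ((hg m hm).1 q e hqm)
  have hnl := h.mem hl
  have hlt := lt_nextIn hJ l
  -- the first three moves of the new descent
  have s0 : IsStop f' (f l + 2) (nextIn J hJ l) (nextIn J hJ m) := by
    refine ⟨by omega, by rw [h.mem hm]; omega, fun y h1 h2 => ?_⟩
    by_cases hy : J y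
    · obtain ⟨w, hw, rfl⟩ := exists_nextIn_eq hJ hy
      rw [h.mem hw]
      have h3 := nextIn_le hJ (lt_of_nextIn_lt hJ hm h1) hw
      have := hq.below w (by omega) (lt_of_nextIn_lt hJ hw h2)
      omega
    · rw [h.notMem hy]
      obtain ⟨v, hv, h3, h4⟩ := exists_floorIn hJ y
      have hvy : v < y := lt_of_le_of_ne h3 fun e => hy (e ▸ hv)
      have h5 := (hg v hv).1 y hvy h4
      have hmv : nextIn J hJ m ≤ v := by
        by_contra hc
        have := nextIn_le hJ (by omega : v < nextIn J hJ m) (nextIn_mem hJ m)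
        omega
      rcases lt_trichotomy v l with h6 | h6 | h6
      · have := hq.below v (by omega) h6
        omega
      · rw [h6] at h5
        omega
      · have := nextIn_le hJ h6 hv
        omega
  have s1 : IsStop f' (f l + 1) (nextIn J hJ l) l := by
    refine ⟨hlt, h.lt hg hl, fun y h1 h2 => ?_⟩
    rw [h.notMem (notMem_of_lt_nextIn hJ h1 h2)]
    have := (hg l hl).1 y h1 h2
    omega
  have s2 : IsStop f' (f l) (nextIn J hJ m) q := by
    refine ⟨hqm, hq.le.trans (h.le hg q), fun y h1 h2 => ?_⟩
    rw [h.notMem (notMem_of_lt_nextIn hJ (by omega) h2)]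
    exact hq.below y h1 (by omega)
  let x' : ℕ → ℤ := fun t => match t with
    | 0 => nextIn J hJ l
    | 1 => nextIn J hJ l
    | 2 => nextIn J hJ m
    | t + 3 => x (t + 1)
  have stops : ∀ t < f l, 0 < t → ∀ y : ℤ, x (t + 2) < y → y < x t → ¬ J y :=
    fun t ht h0 => hx.notMem hg ht fun e => by omega
  refine ⟨x', ⟨rfl, rfl, fun t ht => ?_⟩, ?_, rfl, fun α => ?_⟩
  · rw [hnl] at ht ⊢
    match t with
    | 0 => exact s0
    | 1 =>
      show IsStop f' (f l + 1) (nextIn J hJ l) (x 1)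
      rw [hx.one]
      exact s1
    | 2 =>
      show IsStop f' (f l) (nextIn J hJ m) (x 2)
      rw [hxq (by omega)]
      exact s2
    | t + 3 =>
      have e : f l + 2 - (t + 3) = f l - (t + 1) := by omega
      rw [e]
      exact h.isStop hg (hx.isStop (t + 1) (by omega)) (stops (t + 1) (by omega) (by omega))
  · match hn : f l with
    | 0 =>
      show nextIn J hJ m = x 0
      rw [hx.zero, hq0 hn]
    | n + 1 => rfl
  · have hind : ((nextIn J hJ l : ℤ) : ZMod d) = rotate J hJ α ↔ (l : ZMod d) = α := by
      rw [← rotate_mem hJ hl, (rotate J hJ).injective.eq_iff]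
    have hcount : residueCount (rotate J hJ α) (nextIn J hJ m) (nextIn J hJ l) +
        residueCount (rotate J hJ α) q (nextIn J hJ m) =
        residueCount (rotate J hJ α) l (nextIn J hJ l) + residueCount α q l := by
      by_cases hα : J α
      · have hα' := (rotate_mem_iff hJ α).2 hα
        rw [residueCount_rotate_of_mem hJ hl hm hmq hqm hα,
          residueCount_eq_zero (a := q) (b := nextIn J hJ m),
          residueCount_eq_zero (a := l) (b := nextIn J hJ l)]
        · omega
        · intro y h1 h2 h3
          exact notMem_of_lt_nextIn hJ h1 h2 (h3 ▸ hα')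
        · intro y h1 h2 h3
          exact notMem_of_lt_nextIn hJ (hmq.trans_lt h1) h2 (h3 ▸ hα')
      · rw [rotate_notMem hJ hα, residueCount_add α hml hlt.le fun e => hα (e ▸ hl),
          residueCount_add α hqm.le hml fun e => hα (e ▸ nextIn_mem hJ m)]
        omega
    unfold passCount
    simp only [hnl, h.neg_one_pow, hind]
    match hn : f l with
    | 0 =>
      simp only [Finset.sum_range_succ, Finset.sum_range_zero, x', hx.one, hq0 hn]
      simp [pow_add]
    | n + 1 =>
      rw [Finset.sum_range_succ' _ (n + 2), Finset.sum_range_succ' _ (n + 1),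
        Finset.sum_range_succ' _ n, Finset.sum_range_succ' _ n]
      have e : ∀ t ∈ Finset.range n,
          (-1 : ℤ) ^ (n + 1 + 2 + (t + 1 + 1 + 1) + f α) *
            (residueCount (rotate J hJ α) (x' (t + 1 + 1 + 1 + 2)) (x' (t + 1 + 1 + 1)) : ℤ) =
          (-1) ^ (n + 1 + (t + 1) + f α) * (residueCount α (x (t + 1 + 2)) (x (t + 1)) : ℤ) := by
        intro t ht
        have e1 : n + 1 + 2 + (t + 1 + 1 + 1) + f α = n + 1 + (t + 1) + f α + 2 + 2 := by ring
        rw [e1, pow_add, pow_add]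
        show _ * (residueCount (rotate J hJ α) (x (t + 3)) (x (t + 1)) : ℤ) = _
        rw [residueCount_rotate_of_notMem hJ
          (stops (t + 1) (by have := Finset.mem_range.1 ht; omega) (by omega))]
        ring
      rw [Finset.sum_congr rfl e]
      simp only [x', hx.one, hx.zero, hxq (by omega), zero_add]
      have hc : ((residueCount (rotate J hJ α) (nextIn J hJ m) (nextIn J hJ l) : ℕ) : ℤ) +
        (residueCount (rotate J hJ α) q (nextIn J hJ m) : ℤ) =
        (residueCount (rotate J hJ α) l (nextIn J hJ l) : ℤ) + (residueCount α q l : ℤ) := by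
        exact_mod_cast hcount
      simp only [pow_add, pow_one, pow_zero]
      linear_combination ((-1 : ℤ) ^ n * (-1) * (-1) ^ f α) * hc

end Rotation

/-! ### Balanced functions -/

noncomputable section Balanced

variable {d : ℕ}

/-- Going up from a position `w` with `c w > 0`, as far as the next position at which `c` is at
least `c w`, the function `f` does not exceed `f w`, except possibly by one at that position. -/
def IsBalanced (f c : ZMod d → ℕ) : Prop :=
  ∀ w : ℤ, 1 ≤ c w → ∀ z : ℤ, w < z → (∀ y : ℤ, w < y → y < z → c y < c w) →
    f z ≤ f w + 1 ∧ (c z < c w → f z ≤ f w)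

theorem exists_of_residueCount_ne_zero {α : ZMod d} {a b : ℤ} (h : residueCount α a b ≠ 0) :
    ∃ y : ℤ, a < y ∧ y < b ∧ (y : ZMod d) = α := by
  by_contra hc
  push Not at hc
  exact h (residueCount_eq_zero hc)

/-- If the counts of `w` and of its parent cancel in the descent from the parent, then the parent of
`w` is the first position above `w` with a larger value of `f`. By induction on `f w`: as far as
values are capped at `f w + 1`, the function `f` drops by at most one at each step down, hence the
descent from the parent passes over positions in its first move only, and has to pass over `w`
there. -/
theorem eq_parent_of_first_greater {f c : ZMod d → ℕ}
    (hpar : ∀ w : ZMod d, (∀ y, f y ≤ f w) ∨ ∃ (i : ℤ) (x : ℕ → ℤ), f i = f w + 1 ∧ c w ≤ c i ∧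
      IsTrajectory f i x ∧ passCount f i x w + passCount f i x i = 0) (m : ℕ) (w z : ℤ)
    (hm : f w = m) (hwz : w < z) (hfz : f w < f z) (hbelow : ∀ y : ℤ, w < y → y < z → f y ≤ f w) :
    f z = f w + 1 ∧ c w ≤ c z := by
  induction m using Nat.strong_induction_on generalizing w z with
  | h m ih =>
    obtain hmax | ⟨i, x, hi, hc, hx, hsum⟩ := hpar w
    · have := hmax z
      omega
    have drop : ∀ (y : ℤ) (j : ℕ), j ≤ f i → j ≤ f y → j ≤ f (y - 1 : ℤ) + 1 := by
      intro y j hj hy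
      by_contra hlt
      have := (ih _ (by omega) (y - 1) y rfl (by omega) (by omega) fun v h1 h2 => by omega).1
      omega
    -- after the first move nothing is passed over
    have hstep : ∀ t < f i, 0 < t → x (t + 2) = x t - 1 := by
      intro t ht h0
      have hs := hx.isStop t ht
      refine hs.unique ⟨by omega, ?_, fun y h1 h2 => by omega⟩
      have h1 := hx.le_apply (t := t) (by omega)
      have := drop (x t) (f i - t + 1) (by omega) (by omega)
      omega
    have hcount : ∀ α : ZMod d, passCount f i x α =
        (-1) ^ (f i + f α) * (residueCount α (x 2) i : ℤ) +
          (-1) ^ (f i + f α) * (if (i : ZMod d) = α then 1 else 0) := by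
      intro α
      unfold passCount
      rw [Finset.sum_eq_single_of_mem 0 (by simp; omega)]
      · simp [hx.zero]
      · intro t ht h0
        rw [hstep t (Finset.mem_range.1 ht) (by omega), residueCount_eq_zero, Nat.cast_zero,
          mul_zero]
        intro y h1 h2
        omega
    have hs := hx.isStop 0 (by omega)
    rw [hx.zero, zero_add] at hs
    have hself : passCount f i x i = 1 := by
      rw [hcount, residueCount_eq_zero]
      · simp
      · intro y h1 h2 h3
        have := hs.below y h1 h2
        rw [h3] at this
        omega
    have hne : (i : ZMod d) ≠ w := fun e => by
      rw [e] at hi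
      omega
    obtain ⟨y, h1, h2, h3⟩ : ∃ y : ℤ, x 2 < y ∧ y < i ∧ (y : ZMod d) = w := by
      apply exists_of_residueCount_ne_zero
      intro h0
      rw [hself, hcount, if_neg hne, h0] at hsum
      simp at hsum
    -- `i` and the translate of `z` are both the first position above `y` with a larger value
    have hper : ∀ v : ℤ, ((v + (y - w) : ℤ) : ZMod d) = v := fun v => by
      push_cast
      rw [h3]
      ring
    have hzi : z + (y - w) = i := by
      rcases lt_trichotomy (z + (y - w)) i with h | h | h
      · have := hs.below (z + (y - w)) (by omega) h
        rw [hper] at this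
        omega
      · exact h
      · have h4 := hbelow (i + (w - y)) (by omega) (by omega)
        have h5 := hper (i + (w - y))
        rw [show i + (w - y) + (y - w) = i by ring] at h5
        rw [← h5] at h4
        omega
    rw [← hper z, hzi]
    exact ⟨hi, hc⟩

theorem isBalanced_of_parent {f c : ZMod d → ℕ}
    (hpar : ∀ w : ZMod d, (∀ y, f y ≤ f w) ∨ ∃ (i : ℤ) (x : ℕ → ℤ), f i = f w + 1 ∧ c w ≤ c i ∧
      IsTrajectory f i x ∧ passCount f i x w + passCount f i x i = 0) : IsBalanced f c := by
  intro w hw z hwz hlt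
  have hfirst := eq_parent_of_first_greater hpar
  -- before `c w` is reached again there is no value of `f` above `f w`
  have hle : ∀ (n : ℕ) (y : ℤ), y = w + 1 + n → y < z → f y ≤ f w := by
    intro n
    induction n using Nat.strong_induction_on with
    | h n ih =>
      intro y hy hyz
      by_contra hc
      have := (hfirst _ w y rfl (by omega) (by omega) fun v h1 h2 =>
        ih (v - w - 1).toNat (by omega) v (by omega) (by omega)).2
      have := hlt y (by omega) hyz
      omega
  have hle' : ∀ y : ℤ, w < y → y < z → f y ≤ f w := fun y h1 h2 =>
    hle (y - w - 1).toNat y (by omega) h2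
  by_cases hfz : f z ≤ f w
  · exact ⟨by omega, fun _ => hfz⟩
  · have := hfirst _ w z rfl hwz (by omega) hle'
    exact ⟨by omega, fun _ => by omega⟩

variable [NeZero d]

theorem IsBalanced.isGentle {f c : ZMod d → ℕ} (h : IsBalanced f c) {J : ZMod d → Prop}
    {hJ : ∃ a, J a} (hJc : ∀ z, J z ↔ 1 ≤ c z) : IsGentle J hJ f := by
  intro w hJw
  have hw := (hJc w).1 hJw
  have hlt : ∀ y : ℤ, w < y → y < nextIn J hJ w → c y < c w := fun y h1 h2 => by
    have h3 := notMem_of_lt_nextIn hJ h1 h2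
    rw [hJc, not_le] at h3
    exact h3.trans_le hw
  exact ⟨fun y h1 h2 => (h w hw y h1 fun v h3 h4 => hlt v h3 (by omega)).2 (hlt y h1 h2),
    (h w hw _ (lt_nextIn hJ w) hlt).1⟩

/-- The balance condition is preserved by one rotation along the set where `c` is positive, which
uses up one unit of `c`. -/
theorem IsBalanced.raise {f c f' : ZMod d → ℕ} (h : IsBalanced f c) {J : ZMod d → Prop}
    {hJ : ∃ a, J a} (hJc : ∀ z, J z ↔ 1 ≤ c z) (hf : IsRaise J hJ f f') :
    IsBalanced f' fun z => c ((rotate J hJ).symm z) - 1 := by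
  have hg : IsGentle J hJ f := h.isGentle hJc
  have hin : ∀ w : ℤ, J w → c ((rotate J hJ).symm (nextIn J hJ w : ℤ)) = c w := fun w hw => by
    rw [← rotate_mem hJ hw, Equiv.symm_apply_apply]
  have hout : ∀ w : ℤ, ¬ J w → c ((rotate J hJ).symm w) = 0 := fun w hw => by
    have : (rotate J hJ).symm w = w := by rw [Equiv.symm_apply_eq, rotate_notMem hJ hw]
    rw [this]
    rw [hJc] at hw
    omega
  intro w' hw' z' hz' hlt
  dsimp only at hw' hlt ⊢
  have hJw' : J w' := by
    by_contra hc
    rw [hout w' hc] at hw'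
    omega
  obtain ⟨w, hw, rfl⟩ := exists_nextIn_eq hJ hJw'
  rw [hf.mem hw]
  rw [hin w hw] at hw' hlt ⊢
  by_cases hJz' : J z'
  · obtain ⟨z, hz, rfl⟩ := exists_nextIn_eq hJ hJz'
    rw [hf.mem hz, hin z hz]
    obtain ⟨h1, h2⟩ := h w ((hJc w).1 hw) z (lt_of_nextIn_lt hJ hw hz') fun y h3 h4 => by
      by_cases hy : J y
      · have := hlt (nextIn J hJ y) (nextIn_strictMono hJ h3 hy) (nextIn_strictMono hJ h4 hz)
        rw [hin y hy] at this
        omega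
      · rw [hJc] at hy
        omega
    exact ⟨by omega, fun _ => by have := h2 (by omega); omega⟩
  · rw [hf.notMem hJz', hout z' hJz']
    -- the last position of `J` below `z'` bounds `f z'`, and is itself bounded through `w`
    obtain ⟨v, hv, h1, h2⟩ := exists_floorIn hJ z'
    have hvz : v < z' := lt_of_le_of_ne h1 fun e => hJz' (e ▸ hv)
    have h3 := (hg v hv).1 z' hvz h2
    have h4 : nextIn J hJ w ≤ v := by
      by_contra hc
      have := nextIn_le hJ (by omega : v < nextIn J hJ w) (nextIn_mem hJ w)
      omega
    have h5 := (h w ((hJc w).1 hw) v ((lt_nextIn hJ w).trans_le h4) fun y h5 h6 => by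
      by_cases hy : J y
      · have := hlt (nextIn J hJ y) (nextIn_strictMono hJ h5 hy)
          ((nextIn_le hJ h6 hv).trans_lt hvz)
        rw [hin y hy] at this
        omega
      · rw [hJc] at hy
        omega).1
    exact ⟨by omega, fun _ => by omega⟩

/-- Given a balanced pair `(f, c)`, the residue classes can be permuted by `ρ`, and `2 c` added
to `f`, without changing the endpoints and the counts of descents. -/
theorem IsBalanced.exists_perm (k : ℕ) {f c : ZMod d → ℕ} (h : IsBalanced f c)
    (hk : ∀ z, c z ≤ k) :
    ∃ (ρ : Equiv.Perm (ZMod d)) (f' : ZMod d → ℕ), (∀ z, f' (ρ z) = f z + 2 * c z) ∧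
      ∀ (i : ℤ) (x : ℕ → ℤ), IsTrajectory f i x → ∃ (i' : ℤ) (x' : ℕ → ℤ),
        (i' : ZMod d) = ρ i ∧ IsTrajectory f' i' x' ∧ x' (f' i') = x (f i) ∧
        x' (f' i' + 1) = x (f i + 1) ∧
        ∀ α, passCount f' i' x' (ρ α) = passCount f i x α := by
  classical
  induction k generalizing f c with
  | zero =>
    refine ⟨1, f, fun z => ?_, fun i x hx => ⟨i, x, rfl, hx, rfl, rfl, fun α => rfl⟩⟩
    have := hk z
    simp
    omega
  | succ k ih =>
    by_cases hJ : ∃ a, 1 ≤ c a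
    · obtain ⟨J, hJc⟩ : ∃ J : ZMod d → Prop, ∀ z, J z ↔ 1 ≤ c z := ⟨_, fun z => Iff.rfl⟩
      replace hJ : ∃ a, J a := by simpa only [hJc] using hJ
      set ρ := rotate J hJ
      let f₁ : ZMod d → ℕ := fun z => f (ρ.symm z) + if J (ρ.symm z) then 2 else 0
      have hf₁ : IsRaise J hJ f f₁ := fun z => by
        change f (ρ.symm (ρ z)) + (if J (ρ.symm (ρ z)) then 2 else 0) = _
        rw [Equiv.symm_apply_apply]
      have hg : IsGentle J hJ f := h.isGentle hJc
      obtain ⟨ρ', f', h1, h2⟩ := ih (h.raise hJc hf₁) fun z => by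
        have := hk ((rotate J hJ).symm z)
        omega
      refine ⟨ρ.trans ρ', f', fun z => ?_, fun i x hx => ?_⟩
      · rw [Equiv.trans_apply, h1, hf₁ z, Equiv.symm_apply_apply]
        split_ifs with hz
        · have := (hJc z).1 hz
          omega
        · rw [hJc] at hz
          omega
      · obtain ⟨i₁, x₁, e₁, t₁, a₁, b₁, p₁⟩ : ∃ (i' : ℤ) (x' : ℕ → ℤ),
            (i' : ZMod d) = ρ i ∧ IsTrajectory f₁ i' x' ∧ x' (f₁ i') = x (f i) ∧
            x' (f₁ i' + 1) = x (f i + 1) ∧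
            ∀ α, passCount f₁ i' x' (ρ α) = passCount f i x α := by
          by_cases hi : J i
          · obtain ⟨x', t₁, a₁, b₁, p₁⟩ := hx.raise_mem hf₁ hg hi
            refine ⟨_, x', (rotate_mem hJ hi).symm, t₁, ?_, ?_, p₁⟩
            · rw [hf₁.mem hi, a₁]
            · rw [hf₁.mem hi, b₁]
          · obtain ⟨t₁, p₁⟩ := hx.raise_notMem hf₁ hg hi
            refine ⟨i, x, (rotate_notMem hJ hi).symm, t₁, ?_, ?_, p₁⟩
            · rw [hf₁.notMem hi]
            · rw [hf₁.notMem hi]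
        obtain ⟨i₂, x₂, e₂, t₂, a₂, b₂, p₂⟩ := h2 i₁ x₁ t₁
        refine ⟨i₂, x₂, ?_, t₂, a₂.trans a₁, b₂.trans b₁, fun α => ?_⟩
        · rw [e₂, e₁, Equiv.trans_apply]
        · rw [Equiv.trans_apply, p₂, p₁]
    · push Not at hJ
      refine ih h fun z => ?_
      have := hJ z
      omega

end Balanced

/-! ### Uniserial modules with cyclic layers -/

noncomputable section Uniserial

universe u v

variable {R : Type u} [Ring R] {d : ℕ}

/-- A subquotient `B / A` is isomorphic to `S` if `B` and `S` are images of the same module `C` in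
such a way that `A` corresponds to the kernel. -/
theorem nonempty_subquot_equiv {X C S : Type v} [AddCommGroup X] [Module R X] [AddCommGroup C]
    [Module R C] [AddCommGroup S] [Module R S] {A B : Submodule R X} (g : C →ₗ[R] B)
    (hg : Function.Surjective g) (ψ : C →ₗ[R] S) (hψ : Function.Surjective ψ)
    (h : ∀ y, (g y : X) ∈ A ↔ ψ y = 0) : Nonempty (Subquot A B ≃ₗ[R] S) := by
  let q : C →ₗ[R] Subquot A B := (A.submoduleOf B).mkQ ∘ₗ g
  have hq : Function.Surjective q := (Submodule.mkQ_surjective _).comp hg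
  have hk : LinearMap.ker q = LinearMap.ker ψ := by
    ext y
    simp only [q, LinearMap.mem_ker, LinearMap.comp_apply, Submodule.mkQ_apply,
      Submodule.Quotient.mk_eq_zero]
    exact h y
  exact ⟨(q.quotKerEquivOfSurjective hq).symm ≪≫ₗ (Submodule.quotEquivOfEq _ _ hk) ≪≫ₗ
    ψ.quotKerEquivOfSurjective hψ⟩

/-- An isomorphism from a subquotient `B / A` to `S`, as a surjection from `B` with kernel `A`. -/
theorem exists_surjective_of_subquot_equiv {X S : Type v} [AddCommGroup X] [Module R X]
    [AddCommGroup S] [Module R S] {A B : Submodule R X} (h : Nonempty (Subquot A B ≃ₗ[R] S)) :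
    ∃ ψ : B →ₗ[R] S, Function.Surjective ψ ∧ ∀ y : B, (y : X) ∈ A ↔ ψ y = 0 := by
  obtain ⟨e⟩ := h
  refine ⟨e.toLinearMap ∘ₗ (A.submoduleOf B).mkQ,
    e.surjective.comp (Submodule.mkQ_surjective _), fun y => ?_⟩
  simp only [LinearMap.comp_apply, LinearEquiv.coe_coe, Submodule.mkQ_apply,
    EmbeddingLike.map_eq_zero_iff, Submodule.Quotient.mk_eq_zero]
  rfl

/-- `M` is uniserial of length `n`, with the descending chain `c 0 = M, …, c n = 0` of submodules
and layers `T x, T (x + 1), …`. -/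
structure IsCyclicChain (T : ZMod d → ModuleCat.{v} R) {M : Type v} [AddCommGroup M] [Module R M]
    (x : ZMod d) (n : ℕ) (c : ℕ → Submodule R M) : Prop where
  zero : c 0 = ⊤
  last : c n = ⊥
  le : ∀ t < n, c (t + 1) ≤ c t
  layer : ∀ t < n, Nonempty (Subquot (c (t + 1)) (c t) ≃ₗ[R] T (x + t))
  exists_eq : ∀ N, ∃ t ≤ n, N = c t

/-- `M` is uniserial of length `n` with layers `T x, T (x + 1), …` from the top. -/
def IsCyclicUniserial (T : ZMod d → ModuleCat.{v} R) (M : Type v) [AddCommGroup M] [Module R M]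
    (x : ZMod d) (n : ℕ) : Prop := ∃ c : ℕ → Submodule R M, IsCyclicChain T x n c

/-- The modules in the family are simple and pairwise non-isomorphic. -/
structure IsSimpleFamily {ι : Type*} (T : ι → ModuleCat.{v} R) : Prop where
  simple : ∀ i, IsSimpleModule R (T i)
  injective : ∀ i j, Nonempty (T i ≃ₗ[R] T j) → i = j

variable {T : ZMod d → ModuleCat.{v} R} {M M' : Type v} [AddCommGroup M] [Module R M]
  [AddCommGroup M'] [Module R M'] {x : ZMod d} {n : ℕ} {c : ℕ → Submodule R M}

namespace IsCyclicChain

section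

variable (hT : IsSimpleFamily T) (h : IsCyclicChain T x n c)
include hT h

theorem lt {t : ℕ} (ht : t < n) : c (t + 1) < c t := by
  refine lt_of_le_of_ne (h.le t ht) fun e => ?_
  obtain ⟨ψ, h1, h2⟩ := exists_surjective_of_subquot_equiv (h.layer t ht)
  have := hT.simple (x + t)
  have := IsSimpleModule.nontrivial R (T (x + t))
  obtain ⟨y, hy⟩ := exists_ne (0 : T (x + t))
  obtain ⟨z, rfl⟩ := h1 y
  exact hy ((h2 z).1 (e.ge z.2))

theorem strictAnti {s t : ℕ} (hst : s < t) (ht : t ≤ n) : c t < c s := by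
  induction t with
  | zero => omega
  | succ t ih =>
    have := h.lt hT (t := t) (by omega)
    rcases Nat.lt_succ_iff_lt_or_eq.1 hst with h1 | h1
    · exact this.trans (ih h1 (by omega))
    · rwa [h1]

theorem anti {s t : ℕ} (hst : s ≤ t) (ht : t ≤ n) : c t ≤ c s := by
  rcases eq_or_lt_of_le hst with e | e
  · rw [e]
  · exact (h.strictAnti hT e ht).le

theorem le_iff {s t : ℕ} (hs : s ≤ n) (ht : t ≤ n) : c t ≤ c s ↔ s ≤ t := by
  refine ⟨fun hle => ?_, fun hle => h.anti hT hle ht⟩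
  by_contra hc
  exact absurd hle (h.strictAnti hT (not_le.1 hc) hs).not_ge

theorem inj {s t : ℕ} (hs : s ≤ n) (ht : t ≤ n) (e : c s = c t) : s = t :=
  le_antisymm ((h.le_iff hT hs ht).1 e.ge) ((h.le_iff hT ht hs).1 e.le)

theorem card_submodule : Nat.card (Submodule R M) = n + 1 := by
  rw [← Nat.card_fin (n + 1)]
  refine (Nat.card_congr (Equiv.ofBijective (fun t : Fin (n + 1) => c t) ⟨?_, ?_⟩)).symm
  · intro s t e
    exact Fin.ext (h.inj hT (by omega) (by omega) e)
  · intro N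
    obtain ⟨t, ht, rfl⟩ := h.exists_eq N
    exact ⟨⟨t, by omega⟩, rfl⟩

theorem isArtinian : IsArtinian R M := by
  have : Finite (Submodule R M) := Nat.finite_of_card_ne_zero (by rw [h.card_submodule hT]; simp)
  exact (inferInstance : WellFoundedLT (Submodule R M))

theorem covBy {t : ℕ} (ht : t < n) : c (t + 1) ⋖ c t := by
  refine ⟨h.lt hT ht, fun {D} h1 h2 => ?_⟩
  obtain ⟨r, hr, rfl⟩ := h.exists_eq D
  have h3 := (h.le_iff hT (by omega) hr).1 h2.le
  have h4 := (h.le_iff hT hr (by omega)).1 h1.le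
  rcases (show r = t ∨ r = t + 1 by omega) with rfl | rfl
  · exact lt_irrefl _ h2
  · exact lt_irrefl _ h1

theorem eq_succ_of_covBy {s t : ℕ} (hs : s ≤ n) (ht : t ≤ n) (hcov : c s ⋖ c t) : s = t + 1 := by
  have h1 : t < s := by
    by_contra hc
    exact absurd hcov.lt (h.anti hT (not_lt.1 hc) ht).not_gt
  by_contra hc
  exact hcov.2 (h.strictAnti hT (show t + 1 < s by omega) hs) (h.lt hT (by omega))

theorem factorsIn_iff {C : Set (ZMod d)} {r s : ℕ} (hrs : r ≤ s) (hs : s ≤ n) :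
    FactorsIn T C (c s) (c r) ↔ ∀ t, r ≤ t → t < s → x + t ∈ C := by
  constructor
  · intro hF t h1 h2
    obtain ⟨e⟩ := h.layer t (by omega)
    have := hT.simple (x + t)
    have hsimple : IsSimpleModule R (Subquot (c (t + 1)) (c t)) := IsSimpleModule.congr e
    obtain ⟨α, hα, ⟨e'⟩⟩ := hF _ _ (h.anti hT (by omega) hs) (h.le t (by omega))
      (h.anti hT h1 (by omega)) hsimple
    rwa [hT.injective _ _ ⟨e.symm ≪≫ₗ e'⟩]
  · intro hC A B h1 h2 h3 h4
    have hcov := (covBy_iff_quot_is_simple h2).2 h4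
    obtain ⟨a, ha, rfl⟩ := h.exists_eq A
    obtain ⟨b, hb, rfl⟩ := h.exists_eq B
    obtain rfl := h.eq_succ_of_covBy hT ha hb hcov
    have h5 := (h.le_iff hT ha hs).1 h1
    have h6 := (h.le_iff hT (by omega) hb).1 h3
    exact ⟨_, hC b h6 (by omega), h.layer b (by omega)⟩

/-- The largest submodule above `c s` with all further factors in `C` is found by going up from
`c s` until a factor outside `C` is met. -/
theorem isGreatest_factorsIn {C : Set (ZMod d)} {r s : ℕ} (hr : 0 < r) (hrs : r ≤ s) (hs : s ≤ n)
    (hC : ∀ t, r ≤ t → t < s → x + t ∈ C) (hC' : x + (r - 1 : ℕ) ∉ C) :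
    IsGreatest {N | c s ≤ N ∧ FactorsIn T C (c s) N} (c r) := by
  refine ⟨⟨h.anti hT hrs hs, (h.factorsIn_iff hT hrs hs).2 hC⟩, ?_⟩
  rintro N ⟨h1, h2⟩
  obtain ⟨t, ht, rfl⟩ := h.exists_eq N
  have h3 := (h.le_iff hT ht hs).1 h1
  rw [h.le_iff hT (by omega) ht]
  by_contra hc
  exact hC' ((h.factorsIn_iff hT h3 hs).1 h2 (r - 1) (by omega) (by omega))

/-- A module that is isomorphic to the subquotient `c s / c t` is again uniserial. -/
theorem subquot {s t : ℕ} (hst : s ≤ t) (ht : t ≤ n) (φ : c s →ₗ[R] M')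
    (hφ : Function.Surjective φ) (hk : ∀ y, φ y = 0 ↔ (y : M) ∈ c t) :
    IsCyclicUniserial T M' (x + s) (t - s) := by
  have hmem : ∀ (k : ℕ), k ≤ t - s → ∀ y : c s,
      φ y ∈ ((c (s + k)).submoduleOf (c s)).map φ ↔ (y : M) ∈ c (s + k) := by
    intro k hk' y
    constructor
    · rintro ⟨z, hz, e⟩
      have h1 : (((y - z : c s)) : M) ∈ c t := by rw [← hk, map_sub, e, sub_self]
      have h2 : ((y - z : c s) : M) + (z : M) ∈ c (s + k) :=
        add_mem (h.anti hT (by omega) ht h1) hz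
      simpa using h2
    · intro hy
      exact ⟨y, hy, rfl⟩
  refine ⟨fun k => ((c (s + k)).submoduleOf (c s)).map φ, ⟨?_, ?_, ?_, ?_, ?_⟩⟩
  · rw [eq_top_iff]
    intro z _
    obtain ⟨y, rfl⟩ := hφ z
    exact (hmem 0 (by omega) y).2 y.2
  · rw [eq_bot_iff]
    intro z hz
    obtain ⟨y, rfl⟩ := hφ z
    rw [hmem _ le_rfl, show s + (t - s) = t by omega] at hz
    exact (hk y).2 hz
  · intro k hk'
    exact Submodule.map_mono (Submodule.comap_mono (h.le (s + k) (by omega)))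
  · intro k hk'
    obtain ⟨ψ, h1, h2⟩ := exists_surjective_of_subquot_equiv (h.layer (s + k) (by omega))
    have hle : c (s + k) ≤ c s := h.anti hT (by omega) (by omega)
    let g : c (s + k) →ₗ[R] ((c (s + k)).submoduleOf (c s)).map φ :=
      (φ ∘ₗ Submodule.inclusion hle).codRestrict _ fun y => ⟨Submodule.inclusion hle y, y.2, rfl⟩
    have e : x + s + k = x + ((s + k : ℕ) : ZMod d) := by push_cast; ring
    rw [e]
    refine nonempty_subquot_equiv g ?_ ψ h1 ?_
    · rintro ⟨_, y, hy, rfl⟩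
      exact ⟨⟨y, hy⟩, rfl⟩
    · intro y
      exact (hmem (k + 1) (by omega) (Submodule.inclusion hle y)).trans (h2 y)
  · intro N
    obtain ⟨r, hr, e⟩ := h.exists_eq ((N.comap φ).map (c s).subtype)
    have hrs : s ≤ r := by
      rw [← h.le_iff hT (by omega) hr, ← e]
      exact Submodule.map_subtype_le _ _
    have hrt : r ≤ t := by
      rw [← h.le_iff hT hr ht, ← e]
      intro y hy
      refine ⟨⟨y, h.anti hT hst ht hy⟩, ?_, rfl⟩
      rw [SetLike.mem_coe, Submodule.mem_comap, (hk _).2 hy]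
      exact zero_mem _
    refine ⟨r - s, by omega, ?_⟩
    ext z
    obtain ⟨y, rfl⟩ := hφ z
    rw [hmem _ (by omega), show s + (r - s) = r by omega, ← e]
    simp

theorem submodule {s : ℕ} (hs : s ≤ n) : IsCyclicUniserial T (c s) (x + s) (n - s) :=
  h.subquot hT hs le_rfl LinearMap.id Function.surjective_id fun y => by
    rw [h.last, Submodule.mem_bot]
    simp

theorem of_surjective {t : ℕ} (ht : t ≤ n) (f : M →ₗ[R] M') (hf : Function.Surjective f)
    (hk : LinearMap.ker f = c t) : IsCyclicUniserial T M' x t := by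
  have h0 : ∀ y, y ∈ c 0 := fun y => by rw [h.zero]; trivial
  have := h.subquot hT (Nat.zero_le t) ht (f ∘ₗ (c 0).subtype)
    (fun z => by
      obtain ⟨y, rfl⟩ := hf z
      exact ⟨⟨y, h0 y⟩, rfl⟩)
    fun y => by rw [← hk]; rfl
  simpa using this

end

end IsCyclicChain

namespace IsCyclicUniserial

theorem congr (hT : IsSimpleFamily T) (h : IsCyclicUniserial T M x n) (e : M ≃ₗ[R] M') :
    IsCyclicUniserial T M' x n := by
  obtain ⟨c, h⟩ := h
  exact h.of_surjective hT le_rfl e.toLinearMap e.surjective (by rw [h.last]; simp)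

theorem length_unique (hT : IsSimpleFamily T) {y : ZMod d} {m : ℕ} (h : IsCyclicUniserial T M x n)
    (h' : IsCyclicUniserial T M y m) : n = m := by
  obtain ⟨c, h⟩ := h
  obtain ⟨c', h'⟩ := h'
  have := h.card_submodule hT
  rw [h'.card_submodule hT] at this
  omega

theorem of_subsingleton [Subsingleton M] : IsCyclicUniserial T M x 0 :=
  ⟨fun _ => ⊥, Subsingleton.elim _ _, rfl, by simp, by simp,
    fun _ => ⟨0, le_rfl, Subsingleton.elim _ _⟩⟩

theorem subsingleton (h : IsCyclicUniserial T M x 0) : Subsingleton M := by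
  obtain ⟨c, h⟩ := h
  have : (⊥ : Submodule R M) = ⊤ := h.last.symm.trans h.zero
  exact (Submodule.subsingleton_iff R).1 (subsingleton_of_bot_eq_top this)

theorem of_simple (hT : IsSimpleFamily T) : IsCyclicUniserial T (T x) x 1 := by
  have := hT.simple x
  have hc : ∀ N : Submodule R (T x), N = ⊥ ∨ N = ⊤ := fun N => eq_bot_or_eq_top N
  refine ⟨fun t => if t = 0 then ⊤ else ⊥, rfl, rfl, ?_, ?_, ?_⟩
  · intro t ht
    simp
  · intro t ht
    obtain rfl : t = 0 := by omega
    rw [Nat.cast_zero, add_zero]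
    exact nonempty_subquot_equiv LinearMap.id Function.surjective_id (⊤ : Submodule R (T x)).subtype
      (fun y => ⟨⟨y, trivial⟩, rfl⟩) fun y => by simp
  · intro N
    rcases hc N with rfl | rfl
    · exact ⟨1, le_rfl, rfl⟩
    · exact ⟨0, by omega, rfl⟩

end IsCyclicUniserial

open Classical in
/-- The multiplicities of the composition factors can be read off from the layers. -/
theorem IsCyclicUniserial.compositionMultiplicity_eq (hT : IsSimpleFamily T)
    (h : IsCyclicUniserial T M x n) (α : ZMod d) :
    compositionMultiplicity (ModuleCat.of R M) (T α) =
      ((Finset.range n).filter fun t : ℕ => x + t = α).card := by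
  obtain ⟨c, h⟩ := h
  have key : ∀ s : CompositionSeries (Submodule R M), s.head = ⊥ → s.last = ⊤ →
      Nat.card {t : Fin s.length // Nonempty (Subquot (s t.castSucc) (s t.succ) ≃ₗ[R] T α)} =
      ((Finset.range n).filter fun t : ℕ => x + t = α).card := by
    intro s hbot htop
    have hs : ∀ t : ℕ, ∀ ht : t < s.length + 1, t ≤ n ∧ s ⟨t, ht⟩ = c (n - t) := by
      intro t
      induction t with
      | zero =>
        intro _
        exact ⟨by omega, by rw [Nat.sub_zero, h.last, ← hbot]; rfl⟩
      | succ t ih =>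
        intro ht
        obtain ⟨h1, h2⟩ := ih (by omega)
        have h3 : s ⟨t, by omega⟩ ⋖ s ⟨t + 1, ht⟩ := s.step ⟨t, by omega⟩
        obtain ⟨r, hr, e⟩ := h.exists_eq (s ⟨t + 1, ht⟩)
        rw [h2, e] at h3
        have := h.eq_succ_of_covBy hT (by omega) hr h3
        exact ⟨by omega, by rw [e]; congr 1; omega⟩
    have hlen : s.length = n := by
      obtain ⟨h1, h2⟩ := hs s.length (by omega)
      have h3 : c 0 = c (n - s.length) := by
        rw [← h2, h.zero, ← htop]
        rfl
      have := h.inj hT (by omega) (by omega) h3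
      omega
    have hiff : ∀ t : Fin s.length, Nonempty (Subquot (s t.castSucc) (s t.succ) ≃ₗ[R] T α) ↔
        x + (n - 1 - t : ℕ) = α := by
      intro t
      have h1 : s t.castSucc = c (n - 1 - t + 1) := by
        rw [show n - 1 - (t : ℕ) + 1 = n - t by omega]
        exact (hs t (by omega)).2
      have h2 : s t.succ = c (n - 1 - t) := by
        rw [show n - 1 - (t : ℕ) = n - (t + 1) by omega]
        exact (hs (t + 1) (by omega)).2
      rw [h1, h2]
      obtain ⟨e⟩ := h.layer (n - 1 - t) (by omega)
      constructor
      · rintro ⟨e'⟩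
        exact hT.injective _ _ ⟨e.symm ≪≫ₗ e'⟩
      · rintro rfl
        exact ⟨e⟩
    rw [Nat.card_congr (Equiv.subtypeEquivRight hiff), Nat.card_eq_fintype_card,
      Fintype.card_subtype]
    refine Finset.card_bij (fun t _ => n - 1 - t) ?_ ?_ ?_
    · intro t ht
      simp only [Finset.mem_filter, Finset.mem_univ, true_and, Finset.mem_range] at ht ⊢
      exact ⟨by omega, ht⟩
    · intro t _ t' _ e
      exact Fin.ext (by omega)
    · intro t ht
      simp only [Finset.mem_filter, Finset.mem_range] at ht
      refine ⟨⟨n - 1 - t, by omega⟩, ?_, ?_⟩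
      · simp only [Finset.mem_filter, Finset.mem_univ, true_and]
        rw [show n - 1 - (n - 1 - t) = t by omega]
        exact ht.2
      · show n - 1 - (n - 1 - t) = t
        omega
  let s₀ : CompositionSeries (Submodule R M) :=
    { length := n
      toFun := fun t => c (n - t)
      step := fun t => by
        have := h.covBy hT (t := n - (t + 1)) (by omega)
        rw [show n - ((t : ℕ) + 1) + 1 = n - t by omega] at this
        exact this }
  have hbot : s₀.head = ⊥ := by
    show c (n - 0) = ⊥
    rw [Nat.sub_zero, h.last]
  have htop : s₀.last = ⊤ := by
    show c (n - n) = ⊤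
    rw [Nat.sub_self, h.zero]
  unfold compositionMultiplicity
  rw [show {m : ℕ | ∃ s : CompositionSeries (Submodule R (ModuleCat.of R M)),
    s.head = ⊥ ∧ s.last = ⊤ ∧ m = Nat.card {t : Fin s.length //
      Nonempty (Subquot (s t.castSucc) (s t.succ) ≃ₗ[R] T α)}} =
    {((Finset.range n).filter fun t : ℕ => x + t = α).card} from ?_]
  · exact csSup_singleton _
  · ext m
    simp only [Set.mem_ofPred_eq, Set.mem_singleton_iff]
    constructor
    · rintro ⟨s, h1, h2, rfl⟩
      exact key s h1 h2
    · rintro rfl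
      exact ⟨s₀, hbot, htop, (key s₀ hbot htop).symm⟩

end Uniserial

/-! ### Projective covers and injective hulls of uniserial modules -/

noncomputable section System

universe u v

variable {R : Type u} [Ring R] {d : ℕ}

/-- The simple modules of a self-injective algebra whose indecomposable projective modules are
uniserial of length `N`, `N ≡ 1` modulo `d`, with the simple modules occurring cyclically as
layers. -/
structure IsCyclicSystem (T : ZMod d → ModuleCat.{v} R) (N : ℕ) : Prop where
  family : IsSimpleFamily T
  cast_eq_one : (N : ZMod d) = 1
  cover : ∀ i, ∃ (P : ModuleCat.{v} R) (p : P →ₗ[R] T i), IsProjectiveCover p ∧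
    Module.Injective R P ∧ IsCyclicUniserial T P i N

theorem Module.Injective.of_linearEquiv {P X : Type v} [AddCommGroup P] [Module R P]
    [AddCommGroup X] [Module R X] (h : Module.Injective R P) (e : P ≃ₗ[R] X) :
    Module.Injective R X := by
  refine ⟨fun Y Z _ _ _ _ f hf g => ?_⟩
  obtain ⟨k, hk⟩ := h.out f hf (e.symm.toLinearMap ∘ₗ g)
  refine ⟨e.toLinearMap ∘ₗ k, fun y => ?_⟩
  simp [hk]

/-- Any two projective covers of the same module are isomorphic. -/
theorem IsProjectiveCover.nonempty_equiv {P P' S : Type v} [AddCommGroup P] [Module R P]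
    [AddCommGroup P'] [Module R P'] [AddCommGroup S] [Module R S] {p : P →ₗ[R] S}
    {p' : P' →ₗ[R] S} (h : IsProjectiveCover p) (h' : IsProjectiveCover p') :
    Nonempty (P ≃ₗ[R] P') := by
  obtain ⟨h1, h2, h3⟩ := h
  obtain ⟨h1', h2', h3'⟩ := h'
  have lift : ∀ {A B : Type v} [AddCommGroup A] [Module R A] [AddCommGroup B] [Module R B]
      {a : A →ₗ[R] S} {b : B →ₗ[R] S} (_ : Function.Surjective a)
      (_ : ∀ N : Submodule R B, N ⊔ LinearMap.ker b = ⊤ → N = ⊤) (f : A →ₗ[R] B),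
      b ∘ₗ f = a → Function.Surjective f := by
    intro A B _ _ _ _ a b ha hb f hf
    rw [← LinearMap.range_eq_top]
    apply hb
    rw [eq_top_iff]
    intro y _
    obtain ⟨z, hz⟩ := ha (b y)
    rw [← hf] at hz
    refine Submodule.mem_sup.2 ⟨f z, ⟨z, rfl⟩, y - f z, ?_, by abel⟩
    rw [LinearMap.mem_ker, map_sub, sub_eq_zero]
    exact hz.symm
  obtain ⟨f, hf⟩ := Module.projective_lifting_property p' p h2'
  have hfs := lift h2 h3' f hf
  obtain ⟨g, hg⟩ := Module.projective_lifting_property f LinearMap.id hfs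
  have hgs := lift h2' h3 g (by rw [← hf, LinearMap.comp_assoc, hg, LinearMap.comp_id])
  have hgi : Function.Injective g := Function.LeftInverse.injective (g := f)
    fun y => LinearMap.congr_fun hg y
  exact ⟨(LinearEquiv.ofBijective g ⟨hgi, hgs⟩).symm⟩

variable {T : ZMod d → ModuleCat.{v} R} {N : ℕ} (hS : IsCyclicSystem T N)
  {M M' X : Type v} [AddCommGroup M] [Module R M] [AddCommGroup M'] [Module R M']
  [AddCommGroup X] [Module R X] {x y : ZMod d} {n : ℕ}
include hS

namespace IsCyclicSystem

theorem cover_uniserial {p : M →ₗ[R] T x} (hp : IsProjectiveCover p) :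
    IsCyclicUniserial T M x N := by
  obtain ⟨P, q, h1, -, h2⟩ := hS.cover x
  obtain ⟨e⟩ := h1.nonempty_equiv hp
  exact h2.congr hS.family e

/-- A nonzero uniserial module is a quotient of the projective cover of its top. -/
theorem exists_surjective {P : ModuleCat.{v} R} {p : P →ₗ[R] T x} (hp : IsProjectiveCover p)
    (h : IsCyclicUniserial T M x n) (hn : 0 < n) :
    ∃ f : P →ₗ[R] M, Function.Surjective f := by
  obtain ⟨c, h⟩ := h
  have hlayer := h.layer 0 hn
  rw [Nat.cast_zero, add_zero] at hlayer
  obtain ⟨ψ, h1, h2⟩ := exists_surjective_of_subquot_equiv hlayer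
  have := hp.1
  obtain ⟨f, hf⟩ := Module.projective_lifting_property ψ p h1
  refine ⟨(c 0).subtype ∘ₗ f, ?_⟩
  rw [← LinearMap.range_eq_top]
  obtain ⟨t, ht, e⟩ := h.exists_eq (LinearMap.range ((c 0).subtype ∘ₗ f))
  rcases Nat.eq_zero_or_pos t with rfl | h0
  · rw [e, h.zero]
  · exfalso
    have := hS.family.simple x
    have := IsSimpleModule.nontrivial R (T x)
    obtain ⟨z, hz⟩ := exists_ne (0 : T x)
    obtain ⟨w, rfl⟩ := hp.2.1 z
    apply hz
    rw [← hf, LinearMap.comp_apply, ← h2]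
    apply h.anti hS.family (show 0 + 1 ≤ t by omega) ht
    rw [← e]
    exact ⟨w, rfl⟩

theorem exists_quotient {P : ModuleCat.{v} R} {p : P →ₗ[R] T x} (hp : IsProjectiveCover p)
    {c : ℕ → Submodule R P} (hc : IsCyclicChain T x N c) (h : IsCyclicUniserial T M x n)
    (hn : 0 < n) :
    n ≤ N ∧ ∃ f : P →ₗ[R] M, Function.Surjective f ∧ LinearMap.ker f = c n := by
  obtain ⟨f, hf⟩ := hS.exists_surjective hp h hn
  obtain ⟨t, ht, e⟩ := hc.exists_eq (LinearMap.ker f)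
  obtain rfl := (hc.of_surjective hS.family ht f hf e).length_unique hS.family h
  exact ⟨ht, f, hf, e⟩

theorem length_le (h : IsCyclicUniserial T M x n) : n ≤ N := by
  rcases Nat.eq_zero_or_pos n with rfl | hn
  · omega
  · obtain ⟨P, p, hp, -, c, hc⟩ := hS.cover x
    exact (hS.exists_quotient hp hc h hn).1

/-- A uniserial module is determined by its top and its length. -/
theorem nonempty_equiv (h : IsCyclicUniserial T M x n) (h' : IsCyclicUniserial T M' x n) :
    Nonempty (M ≃ₗ[R] M') := by
  rcases Nat.eq_zero_or_pos n with rfl | hn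
  · have := h.subsingleton
    have := h'.subsingleton
    exact ⟨LinearEquiv.ofSubsingleton M M'⟩
  · obtain ⟨P, p, hp, -, c, hc⟩ := hS.cover x
    obtain ⟨-, f, hf, e⟩ := hS.exists_quotient hp hc h hn
    obtain ⟨-, f', hf', e'⟩ := hS.exists_quotient hp hc h' hn
    exact ⟨(f.quotKerEquivOfSurjective hf).symm ≪≫ₗ
      (Submodule.quotEquivOfEq _ _ (e.trans e'.symm)) ≪≫ₗ f'.quotKerEquivOfSurjective hf'⟩

theorem injective (h : IsCyclicUniserial T M x N) : Module.Injective R M := by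
  obtain ⟨P, p, -, hi, hP⟩ := hS.cover x
  obtain ⟨e⟩ := hS.nonempty_equiv hP h
  exact hi.of_linearEquiv e

theorem isProjectiveCover (h : IsCyclicUniserial T M x N) :
    ∃ p : M →ₗ[R] T x, IsProjectiveCover p := by
  obtain ⟨P, p, ⟨h1, h2, h3⟩, -, hP⟩ := hS.cover x
  obtain ⟨e⟩ := hS.nonempty_equiv h hP
  refine ⟨p ∘ₗ e.toLinearMap, Module.Projective.of_equiv e.symm, h2.comp e.surjective,
    fun K hK => ?_⟩
  have h4 : K.map e.toLinearMap ⊔ LinearMap.ker p = ⊤ := by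
    rw [eq_top_iff]
    intro z _
    obtain ⟨a, ha, b, hb, e'⟩ := Submodule.mem_sup.1
      (hK.ge (trivial : e.symm z ∈ (⊤ : Submodule R M)))
    refine Submodule.mem_sup.2 ⟨e a, ⟨a, ha, rfl⟩, e b, hb, ?_⟩
    rw [← map_add, e', LinearEquiv.apply_symm_apply]
  have h5 := h3 _ h4
  rw [eq_top_iff]
  intro z _
  obtain ⟨a, ha, e'⟩ := h5.ge (trivial : e z ∈ (⊤ : Submodule R P))
  have e'' : a = z := e.injective e'
  exact e'' ▸ ha

theorem submodule_eq {c : ℕ → Submodule R X} (hc : IsCyclicChain T y N c) {L : Submodule R X}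
    (hL : IsCyclicUniserial T L x n) : n ≤ N ∧ L = c (N - n) := by
  obtain ⟨s, hs, rfl⟩ := hc.exists_eq L
  have := (hc.submodule hS.family hs).length_unique hS.family hL
  exact ⟨by omega, by congr 1; omega⟩

theorem isInjectiveHull {c : ℕ → Submodule R X} (hc : IsCyclicChain T y N c) {s : ℕ}
    (hs : s < N) : IsInjectiveHull (c s) := by
  refine ⟨hS.injective ⟨c, hc⟩, fun K hK => ?_⟩
  obtain ⟨t, ht, rfl⟩ := hc.exists_eq K
  have h1 : c (max t s) ≤ c t ⊓ c s :=
    le_inf (hc.anti hS.family (le_max_left _ _) (by omega))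
      (hc.anti hS.family (le_max_right _ _) (by omega))
  rw [hK, ← hc.last, hc.le_iff hS.family le_rfl (by omega)] at h1
  rw [show t = N by omega, hc.last]

/-- The injective hull of a nonzero uniserial module is the indecomposable projective module with
the same socle. -/
theorem hull_uniserial {L : Submodule R X} (hX : IsInjectiveHull L)
    (hL : IsCyclicUniserial T L x n) (hn : 0 < n) (hy : y + 1 = x + n) :
    IsCyclicUniserial T X y N := by
  have hT := hS.family
  have hnN := hS.length_le hL
  obtain ⟨P, p, -, hi, c, hc⟩ := hS.cover y
  have hsub := hc.submodule hT (s := N - n) (by omega)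
  have e1 : y + ((N - n : ℕ) : ZMod d) = x := by
    rw [Nat.cast_sub hnN, hS.cast_eq_one]
    linear_combination hy
  rw [e1, show N - (N - n) = n by omega] at hsub
  obtain ⟨e⟩ := hS.nonempty_equiv hL hsub
  obtain ⟨F, hF⟩ := hi.out L.subtype L.injective_subtype ((c (N - n)).subtype ∘ₗ e.toLinearMap)
  obtain ⟨G, hG⟩ := hX.1.out (c (N - n)).subtype (c (N - n)).injective_subtype
    (L.subtype ∘ₗ e.symm.toLinearMap)
  have hFi : Function.Injective F := by
    rw [← LinearMap.ker_eq_bot]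
    apply hX.2
    rw [eq_bot_iff]
    rintro z ⟨h1, h2⟩
    have := hF ⟨z, h2⟩
    rw [Submodule.subtype_apply, LinearMap.mem_ker.1 h1] at this
    have h3 : e ⟨z, h2⟩ = 0 := Subtype.ext this.symm
    rw [LinearEquiv.map_eq_zero_iff] at h3
    exact congrArg Subtype.val h3
  have hGi : Function.Injective G := by
    rw [← LinearMap.ker_eq_bot]
    apply (hS.isInjectiveHull hc (show N - n < N by omega)).2
    rw [eq_bot_iff]
    rintro z ⟨h1, h2⟩
    have := hG ⟨z, h2⟩
    rw [Submodule.subtype_apply, LinearMap.mem_ker.1 h1] at this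
    have h3 : e.symm ⟨z, h2⟩ = 0 := Subtype.ext this.symm
    rw [LinearEquiv.map_eq_zero_iff] at h3
    exact congrArg Subtype.val h3
  have := hc.isArtinian hT
  have hFG := IsArtinian.surjective_of_injective_endomorphism (F ∘ₗ G) (hFi.comp hGi)
  have hFs : Function.Surjective F := fun z => by
    obtain ⟨w, hw⟩ := hFG z
    exact ⟨G w, hw⟩
  exact IsCyclicUniserial.congr hT ⟨c, hc⟩ (LinearEquiv.ofBijective F ⟨hFi, hFs⟩).symm

theorem isGreatest_factorsIn {C : Set (ZMod d)} {c : ℕ → Submodule R X}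
    (hc : IsCyclicChain T y N c) (hy : y + 1 = x + n) {g : ℕ} (hg : n + g < N)
    (hC : ∀ u < g, x - 1 - (u : ZMod d) ∈ C) (hC' : x - 1 - (g : ZMod d) ∉ C) :
    IsGreatest {K | c (N - n) ≤ K ∧ FactorsIn T C (c (N - n)) K} (c (N - n - g)) := by
  have hcast : ∀ u : ℕ, n + u + 1 ≤ N →
      y + ((N - n - 1 - u : ℕ) : ZMod d) = x - 1 - (u : ZMod d) := by
    intro u hu
    rw [show N - n - 1 - u = N - (n + u + 1) by omega, Nat.cast_sub hu, hS.cast_eq_one]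
    push_cast
    linear_combination hy
  refine hc.isGreatest_factorsIn hS.family (C := C) (r := N - n - g) (s := N - n) (by omega)
    (by omega) (by omega) (fun t h1 h2 => by
      have := hcast (N - n - 1 - t) (by omega)
      rw [show N - n - 1 - (N - n - 1 - t) = t by omega] at this
      rw [this]
      exact hC _ (by omega)) (by
      rw [show N - n - g - 1 = N - n - 1 - g by omega, hcast g (by omega)]
      exact hC')

/-- One step of the algorithm. In the indecomposable projective module `X`, the uniserial submodule
`L` is enlarged by `g` layers with label in `C`, up to the first layer with label outside `C`. -/
theorem step {C : Set (ZMod d)} (hX : IsCyclicUniserial T X y N) {L K : Submodule R X}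
    (hL : IsCyclicUniserial T L x n) (hy : y + 1 = x + n)
    (hK : IsGreatest {K | L ≤ K ∧ FactorsIn T C L K} K) {g : ℕ} (hg : n + g < N)
    (hC : ∀ u < g, x - 1 - (u : ZMod d) ∈ C) (hC' : x - 1 - (g : ZMod d) ∉ C) :
    (∀ f : X →ₗ[R] M, LinearMap.ker f = K →
      IsCyclicUniserial T (LinearMap.range f) y (N - n - g)) ∧
    (∀ φ : K →ₗ[R] M, Function.Surjective φ → (∀ z, φ z = 0 ↔ (z : X) ∈ L) →
      IsCyclicUniserial T M (x - g) g) ∧ IsCyclicUniserial T K (x - g) (n + g) := by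
  have hT := hS.family
  obtain ⟨c, hc⟩ := hX
  obtain ⟨-, rfl⟩ := hS.submodule_eq hc hL
  have hgreat := hS.isGreatest_factorsIn hc hy hg hC hC'
  obtain rfl := hK.unique hgreat
  have e1 : y + ((N - n - g : ℕ) : ZMod d) = x - g := by
    rw [show N - n - g = N - (n + g) by omega, Nat.cast_sub hg.le, hS.cast_eq_one]
    push_cast
    linear_combination hy
  refine ⟨fun f hf => ?_, fun φ hφ hk => ?_, ?_⟩
  · exact hc.of_surjective hT (by omega) f.rangeRestrict f.surjective_rangeRestrict
      (by rw [LinearMap.ker_rangeRestrict, hf])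
  · have := hc.subquot hT (s := N - n - g) (t := N - n) (by omega) (by omega) φ hφ hk
    rwa [e1, show N - n - (N - n - g) = g by omega] at this
  · have := hc.submodule hT (s := N - n - g) (by omega)
    rwa [e1, show N - (N - n - g) = n + g by omega] at this

end IsCyclicSystem

end System

/-! ### Complexes produced by the algorithm -/

noncomputable section Complexes

universe u v

variable {R : Type u} [Ring R]

/-- The homology of a short complex as the quotient of the kernel by the image. -/
theorem exists_surjective_shortComplex_homology (S : ShortComplex (ModuleCat.{v} R)) :
    ∃ φ : LinearMap.ker S.g.hom →ₗ[R] S.homology, Function.Surjective φ ∧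
      ∀ z, φ z = 0 ↔ (z : S.X₂) ∈ LinearMap.range S.f.hom := by
  let e : (LinearMap.ker S.g.hom ⧸ LinearMap.range S.moduleCatToCycles) ≃ₗ[R] S.homology :=
    S.moduleCatHomologyIso.symm.toLinearEquiv
  refine ⟨e.toLinearMap ∘ₗ (LinearMap.range S.moduleCatToCycles).mkQ,
    e.surjective.comp (Submodule.mkQ_surjective _), fun z => ?_⟩
  rw [LinearMap.comp_apply, LinearEquiv.coe_coe, LinearEquiv.map_eq_zero_iff,
    Submodule.mkQ_apply, Submodule.Quotient.mk_eq_zero]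
  constructor
  · rintro ⟨w, rfl⟩
    exact ⟨w, rfl⟩
  · rintro ⟨w, hw⟩
    exact ⟨w, Subtype.ext hw⟩

theorem exists_surjective_homology (X : ChainComplex (ModuleCat.{v} R) ℕ) {i j k : ℕ}
    (hi : (ComplexShape.down ℕ).prev j = i) (hk : (ComplexShape.down ℕ).next j = k) :
    ∃ φ : LinearMap.ker (X.d j k).hom →ₗ[R] X.homology j, Function.Surjective φ ∧
      ∀ z, φ z = 0 ↔ (z : X.X j) ∈ LinearMap.range (X.d i j).hom := by
  subst hi hk
  exact exists_surjective_shortComplex_homology (X.sc j)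

end Complexes

section Counting

theorem coe_negOnePow_sub (a b : ℕ) :
    (((a : ℤ) - (b : ℤ)).negOnePow : ℤ) = (-1) ^ (a + b) := by
  rw [Int.negOnePow_sub, ← Int.negOnePow_add, ← Nat.cast_add, Int.negOnePow_def, zpow_natCast]
  simp

theorem card_filter_range_eq_residueCount {d : ℕ} (α : ZMod d) (a b : ℤ) :
    ((Finset.range (b - a - 1).toNat).filter
      fun t : ℕ => (a : ZMod d) + 1 + t = α).card = residueCount α a b := by
  unfold residueCount
  refine Finset.card_bij (fun t _ => a + 1 + t) ?_ ?_ ?_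
  · intro t ht
    simp only [Finset.mem_filter, Finset.mem_range, Finset.mem_Ioo] at ht ⊢
    refine ⟨by omega, ?_⟩
    rw [← ht.2]
    push_cast
    rfl
  · intro t _ t' _ h
    omega
  · intro z hz
    simp only [Finset.mem_filter, Finset.mem_Ioo] at hz
    refine ⟨(z - a - 1).toNat, ?_, by omega⟩
    simp only [Finset.mem_filter, Finset.mem_range]
    refine ⟨by omega, ?_⟩
    rw [← hz.2]
    have h : a + 1 + ((z - a - 1).toNat : ℤ) = z := by omega
    exact_mod_cast congrArg (fun n : ℤ => (n : ZMod d)) h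

end Counting

noncomputable section Algorithm

universe u

variable {R : Type u} [Ring R] {d : ℕ} {T : ZMod d → ModuleCat.{u} R} {N : ℕ}

/-- The length of the uniserial module that occurs after `t` moves of the algorithm, with projective
modules of length `N`. For even `t` its layers are at the positions `x t, …, x (t + 1)`, and for
odd `t` at the positions `x t, …, x (t + 1) + N - 1`. -/
def stageLength (N : ℕ) (x : ℕ → ℤ) (t : ℕ) : ℕ :=
  if Even t then (x (t + 1) - x t + 1).toNat else N - (x t - x (t + 1)).toNat

variable {π : ZMod d → ℕ} {i : ℤ} {x : ℕ → ℤ}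

theorem IsTrajectory.mem_of_lt (hx : IsTrajectory π i x) {t j : ℕ} (ht : t + j + 1 = π i) :
    (∀ u < (x t - x (t + 2) - 1).toNat,
      (x t : ZMod d) - 1 - (u : ZMod d) ∈ {α | π α < j + 1}) ∧
    (x t : ZMod d) - 1 - ((x t - x (t + 2) - 1).toNat : ZMod d) ∉ {α | π α < j + 1} := by
  have hs := hx.isStop t (by omega)
  have := hs.lt
  have e1 : π i - t = j + 1 := by omega
  rw [e1] at hs
  constructor
  · intro u hu
    have := hs.below (x t - 1 - u) (by omega) (by omega)
    push_cast at this
    exact this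
  · have e : x t - 1 - ((x t - x (t + 2) - 1).toNat : ℤ) = x (t + 2) := by omega
    have e' := congrArg (fun n : ℤ => (n : ZMod d)) e
    push_cast at e'
    rw [e']
    simpa using hs.le

theorem IsTrajectory.cast_sub (hx : IsTrajectory π i x) {t : ℕ} (ht : t < π i) :
    (x t : ZMod d) - ((x t - x (t + 2) - 1).toNat : ZMod d) = x (t + 2) + 1 := by
  have := (hx.isStop t ht).lt
  have e : x t - ((x t - x (t + 2) - 1).toNat : ℤ) = x (t + 2) + 1 := by omega
  exact_mod_cast congrArg (fun n : ℤ => (n : ZMod d)) e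

theorem IsAlgorithmComplex.homology_zero (hS : IsCyclicSystem T N)
    {X : ChainComplex (ModuleCat.{u} R) ℕ} {a : ZMod d} (hX : IsAlgorithmComplex T π a X) :
    IsCyclicUniserial T (X.homology 0) a (if π a = 0 then 1 else 0) := by
  have hT := hS.family
  obtain ⟨φ, hφ, hφ0⟩ := exists_surjective_homology X (i := 1) (j := 0) (k := 0)
    (by simp) (by simp)
  have hd : (X.d 0 0).hom = 0 := by
    rw [X.shape 0 0 (by simp)]
    rfl
  split_ifs with h0
  · have hsub : Subsingleton (X.X 1) := hX.1 _ (by omega)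
    have hφi : Function.Injective φ := by
      rw [← LinearMap.ker_eq_bot, eq_bot_iff]
      intro z hz
      obtain ⟨w, hw⟩ := (hφ0 z).1 hz
      rw [Subsingleton.elim w 0, map_zero] at hw
      exact Subtype.ext hw.symm
    obtain ⟨e⟩ := hX.2.1 h0
    have hker : LinearMap.ker (X.d 0 0).hom = ⊤ := by rw [hd, LinearMap.ker_zero]
    exact (IsCyclicUniserial.of_simple hT).congr hT (e.toLinearEquiv.symm ≪≫ₗ
      Submodule.topEquiv.symm ≪≫ₗ LinearEquiv.ofEq _ _ hker.symm ≪≫ₗ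
      LinearEquiv.ofBijective φ ⟨hφi, hφ⟩)
  · have : Subsingleton (X.homology 0) := by
      refine subsingleton_of_forall_eq 0 fun y => ?_
      obtain ⟨z, rfl⟩ := hφ y
      rw [hφ0]
      exact hX.2.2.1 (by omega) z
    exact IsCyclicUniserial.of_subsingleton

variable [NeZero d]

theorem IsTrajectory.stageLength_pos (hx : IsTrajectory π i x) (hN : d < N) {t : ℕ}
    (ht : t ≤ π i) : 0 < stageLength N x t := by
  obtain ⟨h1, h2⟩ := hx.bounds t ht
  unfold stageLength
  split_ifs with h
  · have := h1 h
    omega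
  · have := h2 h
    omega

theorem IsTrajectory.stageLength_lt (hx : IsTrajectory π i x) (hN : d < N) {t : ℕ}
    (ht : t ≤ π i) : stageLength N x t < N := by
  obtain ⟨h1, h2⟩ := hx.bounds t ht
  unfold stageLength
  split_ifs with h
  · have := h1 h
    omega
  · have := h2 h
    omega

theorem IsTrajectory.stageLength_succ (hx : IsTrajectory π i x) (hN : d < N) {t : ℕ}
    (ht : t < π i) : stageLength N x t + (x t - x (t + 2) - 1).toNat < N ∧
    stageLength N x (t + 1) = N - stageLength N x t - (x t - x (t + 2) - 1).toNat := by
  obtain ⟨h1, h2⟩ := hx.bounds t ht.le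
  obtain ⟨h3, h4⟩ := hx.bounds (t + 1) ht
  have hs := (hx.isStop t ht).lt
  rw [Nat.even_add_one] at h3 h4
  unfold stageLength
  simp only [Nat.even_add_one]
  have e : x (t + 1 + 1) = x (t + 2) := rfl
  rw [e] at h3 h4 ⊢
  by_cases h : Even t
  · simp only [h, not_true_eq_false, if_true, if_false]
    have := h1 h
    have := h4 (by simpa using h)
    omega
  · simp only [h, not_false_eq_true, if_true, if_false]
    have := h2 h
    have := h3 h
    omega

theorem IsTrajectory.cast_stageLength (hx : IsTrajectory π i x) (hN : d < N)
    (hN1 : (N : ZMod d) = 1) {t : ℕ} (ht : t ≤ π i) :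
    (x (t + 1) : ZMod d) + 1 = x t + (stageLength N x t : ZMod d) := by
  obtain ⟨h1, h2⟩ := hx.bounds t ht
  unfold stageLength
  split_ifs with h
  · have := h1 h
    have e : x (t + 1) + 1 = x t + ((x (t + 1) - x t + 1).toNat : ℤ) := by omega
    exact_mod_cast congrArg (fun n : ℤ => (n : ZMod d)) e
  · have := h2 h
    rw [Nat.cast_sub (by omega), hN1]
    have e : x (t + 1) + ((x t - x (t + 1)).toNat : ℤ) = x t := by omega
    have e' := congrArg (fun n : ℤ => (n : ZMod d)) e
    push_cast at e'
    linear_combination e'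

/-- The terms, images and homology of a complex produced by the algorithm are uniserial, with tops
and lengths described by the descent from `i`. -/
theorem IsAlgorithmComplex.uniserial (hS : IsCyclicSystem T N) (hN : d < N)
    (hx : IsTrajectory π i x) {X : ChainComplex (ModuleCat.{u} R) ℕ}
    (hX : IsAlgorithmComplex T π i X) (t : ℕ) : ∀ j : ℕ, t + j + 1 = π i →
    IsCyclicUniserial T (LinearMap.range (X.d (j + 1) j).hom) (x (t + 1))
      (stageLength N x (t + 1)) ∧
    IsCyclicUniserial T (X.homology (j + 1)) (x (t + 2) + 1)
      ((x t - x (t + 2) - 1).toNat + if t = 0 then 1 else 0) := by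
  have hT := hS.family
  induction t with
  | zero =>
    intro j hj
    obtain ⟨⟨p, hp⟩, s, ⟨es⟩, hK⟩ := hX.2.2.2.1 j (by omega)
    have hs : IsCyclicUniserial T s (i : ZMod d) 1 :=
      (IsCyclicUniserial.of_simple hT).congr hT es.symm
    obtain ⟨h1, h2⟩ := hx.stageLength_succ hN (t := 0) (by omega)
    obtain ⟨h3, h4⟩ := hx.mem_of_lt hj
    have h5 := hx.cast_sub (t := 0) (by omega)
    have e0 : stageLength N x 0 = 1 := by simp [stageLength, hx.zero, hx.one]
    rw [e0] at h1 h2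
    rw [hx.zero] at h1 h2 h3 h4 h5 ⊢
    have step := fun (M : Type u) [AddCommGroup M] [Module R M] =>
      hS.step (M := M) (hS.cover_uniserial hp) hs (by rw [Nat.cast_one]) hK h1 h3 h4
    refine ⟨?_, ?_⟩
    · rw [hx.one, h2]
      exact (step _).1 _ rfl
    · have hsub : Subsingleton (X.X (j + 2)) := hX.1 _ (by omega)
      obtain ⟨φ, hφ, hφ0⟩ := exists_surjective_homology X (i := j + 2) (j := j + 1) (k := j)
        (by simp) (by simp)
      have hφi : Function.Injective φ := by
        rw [← LinearMap.ker_eq_bot, eq_bot_iff]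
        intro z hz
        obtain ⟨w, hw⟩ := (hφ0 z).1 hz
        rw [Subsingleton.elim w 0, map_zero] at hw
        exact Subtype.ext hw.symm
      have h6 := (step PUnit).2.2.congr hT (LinearEquiv.ofBijective φ ⟨hφi, hφ⟩)
      rw [h5] at h6
      rw [Nat.add_comm 1] at h6
      rw [if_pos rfl]
      exact h6
  | succ t ih =>
    intro j hj
    obtain ⟨hL, -⟩ := ih (j + 1) (by omega)
    obtain ⟨hI, hK⟩ := hX.2.2.2.2 j (by omega)
    obtain ⟨h1, h2⟩ := hx.stageLength_succ hN (t := t + 1) (by omega)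
    obtain ⟨h3, h4⟩ := hx.mem_of_lt (t := t + 1) hj
    have h5 := hx.cast_sub (t := t + 1) (by omega)
    have hy := hx.cast_stageLength hN hS.cast_eq_one (t := t + 1) (by omega)
    have hU := hS.hull_uniserial hI hL (hx.stageLength_pos hN (by omega)) hy
    refine ⟨?_, ?_⟩
    · rw [h2]
      exact (hS.step hU hL hy hK h1 h3 h4).1 _ rfl
    · obtain ⟨φ, hφ, hφ0⟩ := exists_surjective_homology X (i := j + 2) (j := j + 1) (k := j)
        (by simp) (by simp)
      rw [← h5, if_neg (Nat.succ_ne_zero t), add_zero]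
      exact (hS.step hU hL hy hK h1 h3 h4).2.1 φ hφ hφ0

theorem IsAlgorithmComplex.uniserial_zero (hS : IsCyclicSystem T N) (hN : d < N)
    (hx : IsTrajectory π i x) {X : ChainComplex (ModuleCat.{u} R) ℕ}
    (hX : IsAlgorithmComplex T π i X) :
    IsCyclicUniserial T (X.X 0) (x (π i)) (stageLength N x (π i)) := by
  have hT := hS.family
  rcases Nat.eq_zero_or_pos (π i) with h0 | h0
  · obtain ⟨e⟩ := hX.2.1 h0
    have e0 : stageLength N x 0 = 1 := by simp [stageLength, hx.zero, hx.one]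
    rw [h0, e0, hx.zero]
    exact (IsCyclicUniserial.of_simple hT).congr hT e.toLinearEquiv.symm
  · have h1 := (hX.uniserial hS hN hx (π i - 1) 0 (by omega)).1
    rw [show π i - 1 + 1 = π i by omega] at h1
    have h2 : LinearMap.range (X.d 1 0).hom = ⊤ := LinearMap.range_eq_top.2 (hX.2.2.1 h0)
    exact h1.congr hT ((LinearEquiv.ofEq _ _ h2) ≪≫ₗ Submodule.topEquiv)

/-- The alternating sum of cohomology counts the positions passed over by the descent. -/
theorem IsAlgorithmComplex.altCohomology_eq (hS : IsCyclicSystem T N) (hN : d < N)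
    (hx : IsTrajectory π i x) {X : ChainComplex (ModuleCat.{u} R) ℕ}
    (hX : IsAlgorithmComplex T π i X) (α : ZMod d) :
    altCohomology T π (π i) X α = passCount π i x α := by
  classical
  have hT := hS.family
  have hmult : ∀ t j : ℕ, t + j + 1 = π i →
      compositionMultiplicity (X.homology (j + 1)) (T α) =
        residueCount α (x (t + 2)) (x t) + if t = 0 ∧ (i : ZMod d) = α then 1 else 0 := by
    intro t j htj
    have h1 := (hX.uniserial hS hN hx t j htj).2
    have h2 := h1.compositionMultiplicity_eq hT α
    refine Eq.trans h2 ?_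
    by_cases h0 : t = 0
    · subst h0
      rw [if_pos rfl, Finset.range_add_one, Finset.filter_insert,
        ← card_filter_range_eq_residueCount]
      have e := hx.cast_sub (t := 0) (by omega)
      have e' : ((x (0 + 2) : ℤ) : ZMod d) + 1 + ((x 0 - x (0 + 2) - 1).toNat : ℕ) = i := by
        rw [← e, hx.zero]
        ring
      rw [e']
      by_cases hα : (i : ZMod d) = α
      · rw [if_pos hα, if_pos ⟨rfl, hα⟩, Finset.card_insert_of_notMem (by simp)]
      · rw [if_neg hα, if_neg fun h => hα h.2, add_zero]
    · rw [if_neg h0, if_neg fun h => h0 h.1, add_zero, add_zero,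
        ← card_filter_range_eq_residueCount]
  have hmult0 : compositionMultiplicity (X.homology 0) (T α) =
      if π i = 0 ∧ (i : ZMod d) = α then 1 else 0 := by
    refine Eq.trans ((hX.homology_zero hS).compositionMultiplicity_eq hT α) ?_
    by_cases h0 : π i = 0
    · simp only [h0, if_true, Finset.range_one, Finset.filter_singleton, Nat.cast_zero, add_zero,
        true_and]
      split_ifs <;> simp
    · simp [h0]
  unfold altCohomology passCount
  rw [Finset.sum_range_succ', ← Finset.sum_range_reflect]
  simp only [coe_negOnePow_sub]
  rw [hmult0]
  have hsum : ∀ t ∈ Finset.range (π i),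
      (-1 : ℤ) ^ (π i - 1 - t + 1 + π α) *
        (compositionMultiplicity (X.homology (π i - 1 - t + 1)) (T α) : ℤ) =
      (-1) ^ (π i + t + π α) * (residueCount α (x (t + 2)) (x t) : ℤ) +
        if t = 0 then (-1) ^ (π i + π α) * (if (i : ZMod d) = α then 1 else 0) else 0 := by
    intro t ht
    rw [Finset.mem_range] at ht
    rw [hmult t (π i - 1 - t) (by omega)]
    have e : (-1 : ℤ) ^ (π i + t + π α) = (-1) ^ (π i - 1 - t + 1 + π α) := by
      rw [show π i + t + π α = π i - 1 - t + 1 + π α + 2 * t by omega, pow_add, pow_mul]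
      simp
    rw [← e]
    by_cases h0 : t = 0
    · subst h0
      push_cast
      simp only [true_and, add_zero]
      ring
    · simp [h0]
  rw [Finset.sum_congr rfl hsum, Finset.sum_add_distrib, add_assoc]
  congr 1
  rw [Finset.sum_ite_eq']
  rcases Nat.eq_zero_or_pos (π i) with h0 | h0
  · simp [h0]
  · simp [h0, h0.ne']

end Algorithm

/-! ### Existence of the complexes -/

noncomputable section Existence

universe u

variable {R : Type u} [Ring R] {d : ℕ} {T : ZMod d → ModuleCat.{u} R} {N : ℕ}

/-- A complex with uniserial terms and prescribed images and kernels: `A j` has top `a j` and length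
`m j`, and the differential maps the quotient of `A (j + 1)` of length `κ (j + 1)` onto the
submodule of `A j` of colength `ι j`. -/
theorem IsCyclicSystem.exists_chainComplex (hS : IsCyclicSystem T N) (a : ℕ → ZMod d)
    (m κ ι : ℕ → ℕ) (hm : ∀ j, m j ≤ N) (hι : ∀ j, ι j ≤ m j) (hκι : ∀ j, κ (j + 1) ≤ ι (j + 1))
    (hκ : ∀ j, κ (j + 1) = m j - ι j) (ha : ∀ j, 0 < κ (j + 1) → a (j + 1) = a j + ι j) :
    ∃ (X : ChainComplex (ModuleCat.{u} R) ℕ) (C : ∀ j, ℕ → Submodule R (X.X j)),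
      (∀ j, IsCyclicChain T (a j) (m j) (C j)) ∧
      (∀ j, LinearMap.ker (X.d (j + 1) j).hom = C (j + 1) (κ (j + 1))) ∧
      ∀ j, LinearMap.range (X.d (j + 1) j).hom = C j (ι j) := by
  have hT := hS.family
  have hA : ∀ j, ∃ (A : ModuleCat.{u} R) (C : ℕ → Submodule R A),
      IsCyclicChain T (a j) (m j) C := fun j => by
    obtain ⟨P, -, -, -, c, hc⟩ := hS.cover (a j)
    obtain ⟨C, hC⟩ := hc.of_surjective hT (hm j) (c (m j)).mkQ (Submodule.mkQ_surjective _)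
      (Submodule.ker_mkQ _)
    exact ⟨ModuleCat.of R (P ⧸ c (m j)), C, hC⟩
  choose A C hC using hA
  have hδ : ∀ j, ∃ δ : A (j + 1) →ₗ[R] A j,
      LinearMap.ker δ = C (j + 1) (κ (j + 1)) ∧ LinearMap.range δ = C j (ι j) := fun j => by
    have h1 := (hC (j + 1)).of_surjective hT ((hκι j).trans (hι _)) (C (j + 1) (κ (j + 1))).mkQ
      (Submodule.mkQ_surjective _) (Submodule.ker_mkQ _)
    have h2 := (hC j).submodule hT (hι j)
    rw [← hκ] at h2
    obtain ⟨e⟩ : Nonempty ((A (j + 1) ⧸ C (j + 1) (κ (j + 1))) ≃ₗ[R] C j (ι j)) := by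
      rcases Nat.eq_zero_or_pos (κ (j + 1)) with h0 | h0
      · rw [h0] at h1 h2 ⊢
        have := h1.subsingleton
        have := h2.subsingleton
        exact ⟨LinearEquiv.ofSubsingleton _ _⟩
      · rw [← ha j h0] at h2
        exact hS.nonempty_equiv h1 h2
    refine ⟨(C j (ι j)).subtype ∘ₗ e.toLinearMap ∘ₗ (C (j + 1) (κ (j + 1))).mkQ, ?_, ?_⟩
    · rw [LinearMap.ker_comp_of_ker_eq_bot _ (Submodule.ker_subtype _),
        LinearMap.ker_comp_of_ker_eq_bot _ (LinearEquiv.ker _), Submodule.ker_mkQ]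
    · rw [LinearMap.range_comp, LinearMap.range_comp, Submodule.range_mkQ, Submodule.map_top,
        LinearEquiv.range, Submodule.map_top, Submodule.range_subtype]
  choose δ hker hrange using hδ
  have hsq : ∀ j, ModuleCat.ofHom (δ (j + 1)) ≫ ModuleCat.ofHom (δ j) = 0 := fun j => by
    ext z
    have h1 : δ (j + 1) z ∈ LinearMap.range (δ (j + 1)) := ⟨z, rfl⟩
    rw [hrange] at h1
    have h2 := (hC (j + 1)).anti hT (hκι j) (hι _) h1
    rw [← hker] at h2
    exact h2
  let X := ChainComplex.of A (fun j => ModuleCat.ofHom (δ j)) hsq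
  have hd : ∀ j, X.d (j + 1) j = ModuleCat.ofHom (δ j) := fun j =>
    ChainComplex.of_d A (fun j => ModuleCat.ofHom (δ j)) j
  refine ⟨X, C, hC, fun j => ?_, fun j => ?_⟩
  · rw [hd]
    exact hker j
  · rw [hd]
    exact hrange j

variable [NeZero d]

/-- The algorithm produces a complex for each simple module. -/
theorem IsCyclicSystem.exists_isAlgorithmComplex (hS : IsCyclicSystem T N) (hN : d < N)
    (π : ZMod d → ℕ) (i : ZMod d) :
    ∃ X : ChainComplex (ModuleCat.{u} R) ℕ, IsAlgorithmComplex T π i X := by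
  have hT := hS.family
  obtain ⟨i, rfl⟩ := exists_intCast_eq i
  obtain ⟨x, hx⟩ := exists_isTrajectory π i
  obtain ⟨n, hn⟩ : ∃ n, n = π i := ⟨_, rfl⟩
  have hlt : ∀ t ≤ n, stageLength N x t < N := fun t ht => hx.stageLength_lt hN (hn ▸ ht)
  have hpos : ∀ t ≤ n, 0 < stageLength N x t := fun t ht => hx.stageLength_pos hN (hn ▸ ht)
  have hsucc := fun t (ht : t < n) => hx.stageLength_succ hN (t := t) (hn ▸ ht)
  have e0 : stageLength N x 0 = 1 := by simp [stageLength, hx.zero, hx.one]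
  let a : ℕ → ZMod d := fun j => if j = 0 then x n else x (n + 1 - j)
  let m : ℕ → ℕ := fun j => if j = 0 then stageLength N x n else if j ≤ n then N else 0
  let κ : ℕ → ℕ := fun j => if j ≤ n then stageLength N x (n + 1 - j) else 0
  let ι : ℕ → ℕ := fun j => if j < n then m j - stageLength N x (n - j) else m j
  have hmN : ∀ j, 0 < j → j ≤ n → m j = N := fun j h0 h1 => by
    simp [m, h0.ne', h1]
  have hm : ∀ j, m j ≤ N := fun j => by
    have := hlt n le_rfl
    simp only [m]
    split_ifs <;> omega
  have hm' : ∀ j < n, stageLength N x (n - j) ≤ m j := fun j hj => by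
    rcases Nat.eq_zero_or_pos j with rfl | h0
    · simp [m]
    · rw [hmN j h0 hj.le]
      exact (hlt _ (by omega)).le
  have hκι : ∀ j, κ (j + 1) ≤ ι (j + 1) := fun j => by
    simp only [κ, ι]
    split_ifs with h1 h2 h2
    · rw [hmN _ (by omega) h1, show n + 1 - (j + 1) = n - (j + 1) + 1 by omega]
      have := hsucc (n - (j + 1)) (by omega)
      omega
    · rw [hmN _ (by omega) h1]
      exact (hlt _ (by omega)).le
    · omega
    · omega
  obtain ⟨X, C, hC, hker, hrange⟩ := hS.exists_chainComplex a m κ ι hm (fun j => by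
      simp only [ι]
      split_ifs <;> omega) hκι (fun j => by
      simp only [κ, ι]
      split_ifs with h1 h2 h2
      · have := hm' j h2
        rw [show n + 1 - (j + 1) = n - j by omega]
        omega
      · omega
      · omega
      · omega) (fun j hj => by
      have hjn : j < n := by
        by_contra hc
        simp only [κ, if_neg (show ¬ j + 1 ≤ n by omega)] at hj
        omega
      simp only [a, ι, if_neg (Nat.succ_ne_zero j), if_pos hjn]
      rcases Nat.eq_zero_or_pos j with rfl | h0
      · simp [m]
      · rw [if_neg h0.ne', hmN j h0 hjn.le, Nat.cast_sub (hlt _ (by omega)).le, hS.cast_eq_one,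
          show n + 1 - (j + 1) = n - j by omega, show n + 1 - j = n - j + 1 by omega]
        have := hx.cast_stageLength hN hS.cast_eq_one (t := n - j) (by omega)
        linear_combination -this)
  have hgreat : ∀ t j, t + j + 1 = n → ∀ L : Submodule R (X.X (j + 1)),
      L = C (j + 1) (N - stageLength N x t) →
      IsGreatest {K | L ≤ K ∧ FactorsIn T {α | π α < j + 1} L K}
        (LinearMap.ker (X.d (j + 1) j).hom) := by
    rintro t j htj _ rfl
    obtain ⟨h1, h2⟩ := hsucc t (by omega)
    obtain ⟨h3, h4⟩ := hx.mem_of_lt (t := t) (j := j) (by omega)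
    have hc := hC (j + 1)
    rw [hmN (j + 1) (by omega) (by omega)] at hc
    have hcast := hx.cast_stageLength hN hS.cast_eq_one (t := t) (by omega)
    have ea : a (j + 1) = x (t + 1) := by
      simp only [a, if_neg (Nat.succ_ne_zero j)]
      rw [show n + 1 - (j + 1) = t + 1 by omega]
    have eκ : κ (j + 1) = N - stageLength N x t - (x t - x (t + 2) - 1).toNat := by
      simp only [κ, if_pos (show j + 1 ≤ n by omega)]
      rw [show n + 1 - (j + 1) = t + 1 by omega, h2]
    rw [ea] at hc
    rw [hker, eκ]
    exact hS.isGreatest_factorsIn hc hcast h1 h3 h4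
  refine ⟨X, fun j hj => ?_, fun h0 => ?_, fun h0 => ?_, fun j hj => ⟨?_, ?_⟩, fun j hj => ⟨?_, ?_⟩⟩
  · have : IsCyclicUniserial T (X.X j) (a j) (m j) := ⟨_, hC j⟩
    rw [show m j = 0 by simp only [m]; split_ifs <;> omega] at this
    exact this.subsingleton
  · have h1 : IsCyclicUniserial T (X.X 0) (a 0) (m 0) := ⟨_, hC 0⟩
    have hn0 : n = 0 := hn.trans h0
    have ea : a 0 = i := by simp [a, hn0, hx.zero]
    have em : m 0 = 1 := by simp [m, hn0, e0]
    rw [ea, em] at h1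
    obtain ⟨e⟩ := hS.nonempty_equiv h1 (IsCyclicUniserial.of_simple hT)
    exact ⟨e.toModuleIso⟩
  · rw [← LinearMap.range_eq_top, hrange]
    have : ι 0 = 0 := by simp [ι, m, hn.symm ▸ h0]
    rw [this]
    exact (hC 0).zero
  · have h1 : IsCyclicUniserial T (X.X (j + 1)) (a (j + 1)) (m (j + 1)) := ⟨_, hC _⟩
    have ea : a (j + 1) = i := by
      simp only [a, if_neg (Nat.succ_ne_zero j)]
      rw [show n + 1 - (j + 1) = 1 by omega, hx.one]
    rw [ea, hmN (j + 1) (by omega) (by omega)] at h1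
    exact hS.isProjectiveCover h1
  · have hc := hC (j + 1)
    have ea : a (j + 1) = i := by
      simp only [a, if_neg (Nat.succ_ne_zero j)]
      rw [show n + 1 - (j + 1) = 1 by omega, hx.one]
    rw [hmN (j + 1) (by omega) (by omega), ea] at hc
    refine ⟨C (j + 1) (N - 1), ?_, hgreat 0 j (by omega) _ (by rw [e0])⟩
    have h1 := hc.submodule hT (s := N - 1) (by omega)
    rw [Nat.cast_sub (by omega), hS.cast_eq_one, Nat.cast_one, sub_self, add_zero,
      show N - (N - 1) = 1 by omega] at h1
    exact hS.nonempty_equiv h1 (IsCyclicUniserial.of_simple hT)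
  · have hc := hC (j + 1)
    rw [hmN (j + 1) (by omega) (by omega)] at hc
    have := hpos (n - (j + 1)) (by omega)
    rw [hrange (j + 1)]
    refine hS.isInjectiveHull hc ?_
    simp only [ι, if_pos (show j + 1 < n by omega), hmN (j + 1) (by omega) (by omega)]
    omega
  · refine hgreat (n - (j + 1)) j (by omega) _ ?_
    rw [hrange (j + 1)]
    simp only [ι, if_pos (show j + 1 < n by omega), hmN (j + 1) (by omega) (by omega)]

end Existence

/-! ### Brauer trees: far vertices and parents -/

section Trees

namespace BrauerTree

variable (Γ : BrauerTree)

theorem eq_of_adj_of_dist_lt {v w w' : Γ.V} (h : Γ.graph.Adj v w) (h' : Γ.graph.Adj v w')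
    (hd : Γ.graph.dist Γ.exc w < Γ.graph.dist Γ.exc v)
    (hd' : Γ.graph.dist Γ.exc w' < Γ.graph.dist Γ.exc v) : w = w' := by
  classical
  have hG := Γ.isTree.isAcyclic
  obtain ⟨p, hp, -⟩ := Γ.isTree.connected.exists_path_of_dist Γ.exc v
  have key : ∀ u, Γ.graph.Adj v u → Γ.graph.dist Γ.exc u < Γ.graph.dist Γ.exc v →
      u = p.penultimate := by
    intro u hu hlt
    obtain ⟨q, hq, hq'⟩ := Γ.isTree.connected.exists_path_of_dist Γ.exc u
    refine hG.eq_penultimate_of_adj_end hp hu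
      (hG.mem_support_of_ne_mem_support_of_adj_of_isPath hp hq hu fun hv => ?_)
    have h1 := SimpleGraph.dist_le (q.takeUntil v hv)
    have h2 := q.length_takeUntil_le_length hv
    omega
  rw [key w h hd, key w' h' hd']

theorem exists_eq_mk (e : Γ.Edge) : ∃ u v, e.1 = s(u, v) ∧ Γ.graph.dist Γ.exc u = Γ.depth e ∧
    Γ.graph.dist Γ.exc v = Γ.depth e + 1 := by
  obtain ⟨e, he⟩ := e
  induction e using Sym2.ind with
  | _ u v =>
    have hd : Γ.depth ⟨s(u, v), he⟩ =
        Γ.graph.dist Γ.exc u ⊓ Γ.graph.dist Γ.exc v := rfl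
    rcases Γ.isTree.dist_eq_dist_add_one_of_adj Γ.exc (SimpleGraph.mem_edgeSet _ |>.1 he)
      with h | h
    · exact ⟨v, u, Sym2.eq_swap, by rw [hd]; omega, by rw [hd]; omega⟩
    · exact ⟨u, v, rfl, by rw [hd]; omega, by rw [hd]; omega⟩

variable {Γ}

theorem IsFarVertex.eq {a a' : Γ.Edge} {v : Γ.V} (h : Γ.IsFarVertex a v)
    (h' : Γ.IsFarVertex a' v) : a = a' := by
  have key : ∀ {b : Γ.Edge}, Γ.IsFarVertex b v → ∃ u, b.1 = s(v, u) ∧ Γ.graph.Adj v u ∧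
      Γ.graph.dist Γ.exc u < Γ.graph.dist Γ.exc v := by
    intro b hb
    obtain ⟨u, w, hbe, hu, hw⟩ := Γ.exists_eq_mk b
    have hvw : v = w := by
      have := hb.1
      rw [hbe, Sym2.mem_iff] at this
      rcases this with rfl | rfl
      · have := hb.2
        omega
      · rfl
    subst hvw
    have hadj : Γ.graph.Adj u v := by
      rw [← SimpleGraph.mem_edgeSet, ← hbe]
      exact b.2
    exact ⟨u, hbe.trans Sym2.eq_swap, hadj.symm, by omega⟩
  obtain ⟨u, h1, h2, h3⟩ := key h
  obtain ⟨u', h1', h2', h3'⟩ := key h'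
  obtain rfl := Γ.eq_of_adj_of_dist_lt h2 h2' h3 h3'
  exact Subtype.ext (h1.trans h1'.symm)

theorem exists_isFarVertex {v : Γ.V} (hv : Γ.graph.dist Γ.exc v ≠ 0) :
    ∃ a, Γ.IsFarVertex a v := by
  obtain ⟨p, hp⟩ := Γ.isTree.connected.exists_walk_length_eq_dist Γ.exc v
  have hnil : ¬ p.Nil := fun h => by
    rw [SimpleGraph.Walk.length_eq_zero_iff.2 h] at hp
    omega
  have hadj := p.adj_penultimate hnil
  have hdist : Γ.graph.dist Γ.exc p.penultimate < Γ.graph.dist Γ.exc v := by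
    have h1 := SimpleGraph.dist_le p.dropLast
    have h2 : p.dropLast.length + 1 = p.length := p.length_dropLast_add_one hnil
    omega
  obtain ⟨u, w, h1, h2, h3⟩ := Γ.exists_eq_mk ⟨s(p.penultimate, v), hadj⟩
  refine ⟨⟨s(p.penultimate, v), hadj⟩, Sym2.mem_mk_right _ _, ?_⟩
  have h4 : s(p.penultimate, v) = s(u, w) := h1
  rw [Sym2.eq_iff] at h4
  rcases h4 with ⟨rfl, rfl⟩ | ⟨rfl, rfl⟩
  · exact h3
  · omega

/-- An edge away from the exceptional vertex has a parent, the edge whose far vertex is the near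
vertex of the given edge. The column of the decomposition matrix at an edge has nonzero
entries only at the edge itself and at its parent. -/
theorem exists_parent {e : Γ.Edge} (he : Γ.depth e ≠ 0) :
    ∃ p : Γ.Edge, Γ.depth p + 1 = Γ.depth e ∧ (∃ u, u ∈ e.1 ∧ u ∈ p.1 ∧ u ≠ Γ.exc) ∧
      ∀ a, Γ.decomp a e = open Classical in if a = e ∨ a = p then 1 else 0 := by
  obtain ⟨u, v, h1, h2, h3⟩ := Γ.exists_eq_mk e
  obtain ⟨p, hp⟩ := exists_isFarVertex (v := u) (by omega)
  have he' : Γ.IsFarVertex e v := ⟨by rw [h1]; exact Sym2.mem_mk_right _ _, h3⟩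
  refine ⟨p, by have := hp.2; omega, ⟨u, by rw [h1]; exact Sym2.mem_mk_left _ _, hp.1, ?_⟩, ?_⟩
  · rintro rfl
    rw [SimpleGraph.dist_self] at h2
    exact he h2.symm
  · intro a
    unfold decomp
    congr 1
    rw [eq_iff_iff]
    constructor
    · rintro ⟨w, hw, hwe⟩
      rw [h1, Sym2.mem_iff] at hwe
      rcases hwe with rfl | rfl
      · exact Or.inr (hw.eq hp)
      · exact Or.inl (hw.eq he')
    · rintro (rfl | rfl)
      · exact ⟨v, he', he'.1⟩
      · exact ⟨u, hp, by rw [h1]; exact Sym2.mem_mk_left _ _⟩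

theorem depth_le_maxDepth (e : Γ.Edge) : Γ.depth e ≤ Γ.maxDepth := by
  have : Finite Γ.Edge := Subtype.finite
  exact le_ciSup (Set.finite_range _).bddAbove e

theorem IsCanonicalPerversity.apply_le {π : Γ.Edge → ℕ} (h : Γ.IsCanonicalPerversity π)
    {e : Γ.Edge} (he : Γ.depth e = 0) (f : Γ.Edge) : π f ≤ π e := by
  rcases h with h | h <;> rw [h, h] <;> omega

theorem IsCanonicalPerversity.apply_parent {π : Γ.Edge → ℕ} (h : Γ.IsCanonicalPerversity π)
    {e p : Γ.Edge} (hp : Γ.depth p + 1 = Γ.depth e) : π p = π e + 1 := by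
  have := depth_le_maxDepth e
  rcases h with h | h <;> rw [h, h] <;> omega

end BrauerTree

end Trees

/-! ### Symmetric algebras are self-injective -/

section SelfInjective

universe u w

/-- A finite-dimensional symmetric algebra is self-injective: a homomorphism `f` from a left ideal
composed with the symmetrizing form `t` extends to a linear form on the algebra, which is
`x ↦ t (x * z)` for some `z`, and then right multiplication by `z` extends `f`. -/
theorem injective_self_of_symmetric {k : Type w} [Field k] {B : Type u} [Ring B] [Algebra k B]
    [Module.Finite k B] (h : ∃ t : B →ₗ[k] k, (∀ x y, t (x * y) = t (y * x)) ∧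
      ∀ x, (∀ y, t (x * y) = 0) → x = 0) : Module.Injective B B := by
  obtain ⟨t, hsymm, hnd⟩ := h
  apply Module.Baer.injective
  intro I f
  let β : B →ₗ[k] Module.Dual k B := (LinearMap.mul k B).flip.compr₂ t
  have hβ : ∀ z x, β z x = t (x * z) := fun z x => rfl
  have hinj : Function.Injective β := by
    rw [← LinearMap.ker_eq_bot, eq_bot_iff]
    intro z hz
    refine hnd z fun y => ?_
    rw [hsymm, ← hβ, LinearMap.mem_ker.1 hz, LinearMap.zero_apply]
  have hsurj : Function.Surjective β :=
    (LinearMap.injective_iff_surjective_of_finrank_eq_finrank Subspace.dual_finrank_eq.symm).1 hinj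
  let φ : I.restrictScalars k →ₗ[k] k := t ∘ₗ f.restrictScalars k
  obtain ⟨ψ, hψ⟩ := LinearMap.exists_extend φ
  obtain ⟨z, rfl⟩ := hsurj ψ
  refine ⟨LinearMap.toSpanSingleton B B z, fun x hx => ?_⟩
  rw [LinearMap.toSpanSingleton_apply, smul_eq_mul, ← sub_eq_zero]
  refine hnd _ fun y => ?_
  rw [hsymm, mul_sub, map_sub, sub_eq_zero, ← mul_assoc, ← hβ]
  have h1 : β z (y * x) = φ ⟨y * x, I.mul_mem_left y hx⟩ := by
    rw [← hψ]
    rfl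
  rw [h1]
  show t (f (y • ⟨x, hx⟩)) = _
  rw [map_smul]
  rfl

/-- A direct summand of an injective module is injective. -/
theorem Module.Injective.of_retract {R : Type u} [Ring R] {Q P : Type w} [AddCommGroup Q]
    [Module R Q] [AddCommGroup P] [Module R P] (h : Module.Injective R Q) (r : Q →ₗ[R] P)
    (s : P →ₗ[R] Q) (hrs : r ∘ₗ s = LinearMap.id) : Module.Injective R P := by
  refine ⟨fun Y Z _ _ _ _ f hf g => ?_⟩
  obtain ⟨l, hl⟩ := h.out f hf (s ∘ₗ g)
  refine ⟨r ∘ₗ l, fun y => ?_⟩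
  rw [LinearMap.comp_apply, hl]
  exact LinearMap.congr_fun hrs (g y)

/-- Over a self-injective ring, the projective cover of a simple module is injective. -/
theorem IsProjectiveCover.injective {R : Type u} [Ring R] (hR : Module.Injective R R)
    {P S : Type u} [AddCommGroup P] [Module R P] [AddCommGroup S] [Module R S]
    [IsSimpleModule R S] {p : P →ₗ[R] S} (hp : IsProjectiveCover p) : Module.Injective R P := by
  obtain ⟨h1, h2, h3⟩ := hp
  have := IsSimpleModule.nontrivial R S
  obtain ⟨z, hz⟩ := exists_ne (0 : S)
  obtain ⟨y, rfl⟩ := h2 z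
  let f : R →ₗ[R] P := LinearMap.toSpanSingleton R P y
  have hf : Function.Surjective f := by
    rw [← LinearMap.range_eq_top]
    apply h3
    rw [eq_top_iff]
    intro w _
    obtain ⟨a, ha⟩ := IsSimpleModule.toSpanSingleton_surjective R hz (p w)
    refine Submodule.mem_sup.2 ⟨f a, ⟨a, rfl⟩, w - f a, ?_, by abel⟩
    rw [LinearMap.mem_ker, map_sub, ← ha]
    simp [f]
  obtain ⟨s, hs⟩ := Module.projective_lifting_property f LinearMap.id hf
  exact hR.of_retract f s hs

end SelfInjective

/-! ### The algebra of a star -/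

section Star

universe u w

variable {k : Type w} [Field k] {Δ : BrauerTree} {d : ℕ}
  {b : Type u} [Ring b] [Algebra k b]

/-- The indecomposable projective modules of the algebra of a star with `d` edges and exceptional
multiplicity `m` are uniserial of length `m * d + 1`. -/
theorem BrauerTreeAlgebra.isCyclicSystem (hb : BrauerTreeAlgebra k Δ b) (hΔ : Δ.IsStar)
    (τ : ZMod d ≃ Δ.Edge) (hτ : IsCyclicLabelling τ) :
    IsCyclicSystem (starSimple hb τ) (Δ.excMult * d + 1) := by
  have hT : IsSimpleFamily (starSimple hb τ) :=
    ⟨fun i => hb.isSimple _, fun i j h => τ.injective (hb.simple_injective _ _ h)⟩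
  refine ⟨hT, by simp, fun i => ?_⟩
  have hnext : ∀ n : ℕ, ((Δ.next Δ.exc) ^ n) (τ i) = τ (i + n) := by
    intro n
    induction n with
    | zero => simp
    | succ n ih =>
      rw [pow_succ', Equiv.Perm.mul_apply, ih, hτ]
      push_cast
      rw [add_assoc]
  have hval : Δ.valency Δ.exc = d := by
    unfold BrauerTree.valency
    rw [Nat.card_congr (Equiv.subtypeUnivEquiv hΔ), ← Nat.card_congr τ, Nat.card_zmod]
  have hexc := hΔ (τ i)
  obtain ⟨w, hw⟩ : ∃ w, (τ i).1 = s(Δ.exc, w) := ⟨_, (Sym2.other_spec hexc).symm⟩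
  have hadj : Δ.graph.Adj Δ.exc w := by
    rw [← SimpleGraph.mem_edgeSet, ← hw]
    exact (τ i).2
  have hvalw : Δ.valency w = 1 := by
    unfold BrauerTree.valency
    rw [Nat.card_eq_one_iff_unique]
    refine ⟨⟨fun e f => ?_⟩, ⟨⟨τ i, by rw [hw]; exact Sym2.mem_mk_right _ _⟩⟩⟩
    have key : ∀ e : {e : Δ.Edge // w ∈ e.1}, e.1.1 = s(Δ.exc, w) := fun e =>
      (Sym2.mem_and_mem_iff hadj.ne).1 ⟨hΔ e.1, e.2⟩
    exact Subtype.ext (Subtype.ext ((key e).trans (key f).symm))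
  obtain ⟨P, p, U, hp, hU, hrad⟩ := hb.proj (τ i)
  obtain ⟨c, hc0, hcn, hcl, hcall⟩ := hU _ hexc
  obtain ⟨c', hc0', hcn', hcl', hcall'⟩ := hU w (by rw [hw]; exact Sym2.mem_mk_right _ _)
  obtain ⟨hsup, hsimple⟩ := hrad _ _ hw
  have hmult : Δ.mult Δ.exc = Δ.excMult := by simp [BrauerTree.mult]
  have hmultw : Δ.mult w = 1 := by simp [BrauerTree.mult, hadj.ne']
  rw [hmult, hval] at hcn hcl hcall
  rw [hmultw, hvalw] at hcn' hcl' hcall'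
  -- the branch at the other vertex is the socle, so the radical is the branch at the centre
  have hle : U w ≤ U Δ.exc := by
    obtain ⟨t, ht, e⟩ := hcall' (U Δ.exc ⊓ U w) inf_le_right
    rcases (show t = 0 ∨ t = 1 by omega) with rfl | rfl
    · rw [hc0'] at e
      exact inf_eq_right.1 e
    · exfalso
      have h1 := IsSimpleModule.nontrivial b (U Δ.exc ⊓ U w : Submodule b P)
      rw [Submodule.nontrivial_iff_ne_bot] at h1
      exact h1 (e.trans hcn')
  rw [sup_eq_left.2 hle] at hsup
  have hS : IsSimpleModule b (hb.simple (τ i)) := hb.isSimple _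
  have hinj : Module.Injective b b := by
    have := hb.finite
    exact injective_self_of_symmetric hb.symmetric
  refine ⟨P, p, hp, hp.injective hinj, fun t => if t = 0 then ⊤ else c (t - 1), ?_⟩
  refine ⟨rfl, by simpa using hcn, ?_, ?_, ?_⟩
  · intro t ht
    rcases t with _ | t
    · simp
    · simpa using (hcl t (by omega)).1
  · intro t ht
    rcases t with _ | t
    · rw [Nat.cast_zero, add_zero]
      show Nonempty (Subquot (c 0) ⊤ ≃ₗ[b] starSimple hb τ i)
      rw [hc0, hsup]
      refine nonempty_subquot_equiv LinearMap.id Function.surjective_id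
        (p ∘ₗ (⊤ : Submodule b P).subtype) (fun z => ?_) fun y => Iff.rfl
      obtain ⟨y, rfl⟩ := hp.2.1 z
      exact ⟨⟨y, trivial⟩, rfl⟩
    · have h1 := (hcl t (by omega)).2.2
      show Nonempty (Subquot (c (t + 1)) (c t) ≃ₗ[b] hb.simple (τ (i + (t + 1 : ℕ))))
      rw [← hnext]
      exact h1
  · intro K
    by_cases hK : K ≤ LinearMap.ker p
    · obtain ⟨t, ht, rfl⟩ := hcall K (hK.trans hsup.ge)
      exact ⟨t + 1, by omega, by simp⟩
    · refine ⟨0, by omega, ?_⟩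
      have hco : IsCoatom (LinearMap.ker p) := LinearMap.isCoatom_ker_of_surjective hp.2.1
      exact hp.2.2 K (hco.2 _ (by simpa using hK))

end Star

/-! ### Canonical orderings -/

noncomputable section Canonical

universe u w

variable {k : Type w} [Field k] {Γ : BrauerTree} {d : ℕ} [NeZero d]
  {b : Type u} [Ring b] [Algebra k b]

/-- For a canonical ordering, every function on the edges that increases weakly towards the
exceptional vertex is balanced with respect to the canonical perversity. -/
theorem isBalanced_of_isCanonicalOrdering {T : ZMod d → ModuleCat.{u} b} {N : ℕ}
    (hS : IsCyclicSystem T N) (hN : d < N) {π₀ : Γ.Edge → ℕ} (hπ₀ : Γ.IsCanonicalPerversity π₀)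
    {σ : ZMod d ≃ Γ.Edge} (hσ : IsCanonicalOrdering T π₀ σ) {c : Γ.Edge → ℕ}
    (hc : ∀ (e f : Γ.Edge) (v : Γ.V), v ∈ e.1 → v ∈ f.1 → v ≠ Γ.exc →
      Γ.depth f + 1 = Γ.depth e → c e ≤ c f) : IsBalanced (π₀ ∘ σ) (c ∘ σ) := by
  classical
  refine isBalanced_of_parent fun w => ?_
  by_cases he : Γ.depth (σ w) = 0
  · exact Or.inl fun y => hπ₀.apply_le he _
  · right
    obtain ⟨p, hp, ⟨v, hv, hvp, hvexc⟩, hdecomp⟩ := BrauerTree.exists_parent he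
    obtain ⟨i, hi⟩ := exists_intCast_eq (σ.symm p)
    have hip : σ i = p := by rw [hi, Equiv.apply_symm_apply]
    obtain ⟨x, hx⟩ := exists_isTrajectory (π₀ ∘ σ) i
    obtain ⟨X, hX, hsum⟩ := hσ i
    have hne : σ w ≠ p := fun h => by
      rw [h] at hp
      omega
    have hwi : w ≠ i := fun h => hne (h ▸ hip)
    refine ⟨i, x, ?_, ?_, hx, ?_⟩
    · simp only [Function.comp_apply, hip]
      exact hπ₀.apply_parent hp
    · simp only [Function.comp_apply, hip]
      exact hc _ _ v hv hvp hvexc hp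
    · have h1 := hsum (σ w)
      rw [hip, if_neg hne, ← hip] at h1
      rw [← hX.altCohomology_eq hS hN hx w, ← hX.altCohomology_eq hS hN hx i, ← h1]
      have h2 : ∀ α, Γ.decomp (σ α) (σ w) = if α = w ∨ α = i then 1 else 0 := fun α => by
        rw [hdecomp, ← hip]
        simp only [EmbeddingLike.apply_eq_iff_eq]
      simp only [h2, mul_ite, mul_one, mul_zero]
      rw [← Finset.sum_filter, show (Finset.univ.filter fun α : ZMod d => α = w ∨ α = i) =
        {w, (i : ZMod d)} by ext; simp, Finset.sum_pair hwi]
      rfl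

end Canonical

theorem theorem5p2 {k : Type*} [Field k] {Γ Δ : BrauerTree} {d : ℕ} [NeZero d]
    {B : Type*} [Ring B] [Algebra k B] (hB : BrauerTreeAlgebra k Γ B)
    {b : Type*} [Ring b] [Algebra k b] (hb : BrauerTreeAlgebra k Δ b) (hΔ : Δ.IsStar)
    (τ : ZMod d ≃ Δ.Edge) (hτ : IsCyclicLabelling τ)
    (π₀ : Γ.Edge → ℕ) (hπ₀ : Γ.IsCanonicalPerversity π₀)
    (σ : ZMod d ≃ Γ.Edge) (hσ : IsCanonicalOrdering (starSimple hb τ) π₀ σ)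
    (π' : Γ.Edge → ℕ)
    (hmono : ∀ (e f : Γ.Edge) (v : Γ.V), v ∈ e.1 → v ∈ f.1 → v ≠ Γ.exc →
      Γ.depth f < Γ.depth e → π' e < π' f)
    (heven : ∀ e, ∃ c : ℕ, π' e = π₀ e + 2 * c) :
    ∃ σ' : ZMod d ≃ Γ.Edge,
      AlgorithmicallyEquivalent hB (starSimple hb τ) π₀ σ π' σ' := by
  have hS := hb.isCyclicSystem hΔ τ hτ
  have hN : d < Δ.excMult * d + 1 := Nat.lt_succ_of_le (Nat.le_mul_of_pos_left d Δ.one_le_excMult)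
  choose c hc using heven
  have hbal : IsBalanced (π₀ ∘ σ) (c ∘ σ) :=
    isBalanced_of_isCanonicalOrdering hS hN hπ₀ hσ fun e f v he hf hv hd => by
      -- the parent has canonical perversity one more, so an even excess cannot drop
      have h1 := hmono e f v he hf hv (by omega)
      have h2 := hπ₀.apply_parent hd
      rw [hc, hc] at h1
      omega
  obtain ⟨ρ, f', hf', hρ⟩ := hbal.exists_perm (∑ z, c (σ z)) fun z =>
    Finset.single_le_sum (f := fun z => c (σ z)) (fun _ _ => Nat.zero_le _) (Finset.mem_univ z)
  have hπ' : π' ∘ (ρ.symm.trans σ) = f' := by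
    funext z
    obtain ⟨y, rfl⟩ := ρ.surjective z
    rw [hf']
    simp [hc]
  refine ⟨ρ.symm.trans σ, fun i j hij => ?_⟩
  obtain ⟨e⟩ := hij
  have hσij := hB.simple_injective _ _ ⟨e.toLinearEquiv⟩
  have hj : j = ρ i := by
    rw [Equiv.trans_apply, σ.apply_eq_iff_eq, Equiv.eq_symm_apply] at hσij
    exact hσij.symm
  refine ⟨hS.exists_isAlgorithmComplex hN _ i, hS.exists_isAlgorithmComplex hN _ j,
    fun X X' hX hX' => ?_⟩
  obtain ⟨i, rfl⟩ := exists_intCast_eq i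
  obtain ⟨x, hx⟩ := exists_isTrajectory (π₀ ∘ σ) i
  obtain ⟨i', x', hi', hx', h0, h1, hcount⟩ := hρ i x hx
  obtain rfl : j = (i' : ZMod d) := hj.trans hi'.symm
  rw [← hπ'] at hx' h0 h1 hcount
  constructor
  · have h2 := hX.uniserial_zero hS hN hx
    have h3 := hX'.uniserial_zero hS hN hx'
    have hpar : Even ((π' ∘ (ρ.symm.trans σ)) i') ↔ Even ((π₀ ∘ σ) i) := by
      rw [hπ', hi', hf']
      simp [Nat.even_add]
    rw [h0, show stageLength (Δ.excMult * d + 1) x' ((π' ∘ (ρ.symm.trans σ)) i') =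
      stageLength (Δ.excMult * d + 1) x ((π₀ ∘ σ) i) by
        unfold stageLength
        simp only [h0, h1, hpar]] at h3
    obtain ⟨e⟩ := hS.nonempty_equiv h2 h3
    exact ⟨e.toModuleIso⟩
  · intro e
    have h2 := hX.altCohomology_eq hS hN hx (σ.symm e)
    have h3 := hX'.altCohomology_eq hS hN hx' ((ρ.symm.trans σ).symm e)
    refine h2.trans (Eq.trans ?_ h3.symm)
    exact (hcount (σ.symm e)).symm
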